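/- For $R>0$ let $B(R)\subset\mathbb R^2$ be the disc of radius $R$ centred at the origin, let $$\Gamma_R=\{\lambda\in\mathbb Z^2:\ R-1/\sqrt2<\|\lambda\|<R+1/\sqrt2\}$$ be the set of lattice points in the annulus of width $\sqrt2$ around the circle of radius $R$, and let $K(R)=\#\Gamma_R$. For $\lambda\in\Gamma_R$ let $S(\lambda)=[-\tfrac12,\tfrac12]^2+\lambda$ and $A_R(\lambda)=\operatorname{Area}(S(\lambda)\cap B(R))$. Put $$E(R)=\frac1{K(R)}\sum_{\lambda\in\Gamma_R}A_R(\lambda),\qquad V(R)=\frac1{K(R)}\sum_{\lambda\in\Gamma_R}\bigl(A_R(\lambda)-E(R)\bigr)^2 .$$ Then: (i) $E(R)=\tfrac12+O(R^{-1/3})$; that is, there is an absolute constant $C$ such that $|E(R)-\tfrac12|\le C\,R^{-1/3}$ for all real $R>0$. (ii) $V(R)=c_0+o(1)$ as $R\to\infty$ ($R$ real), where $$c_0=\frac14-\frac1{2\pi\sqrt2}\left(\frac4{15}+\frac{2\log(1+\sqrt2)}3+\frac{2\sqrt2}{15}\right)=0.132642545\ldots>0 .$$ -/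

import Mathlib

open Filter Topology MeasureTheory

noncomputable section

namespace GaussCircle

/-- The Euclidean plane; its `volume` is the Lebesgue measure (area). -/
abbrev Plane : Type := EuclideanSpace ℝ (Fin 2)

/-- The disc `B(R)` of radius `R` centred at the origin. -/
def disc (R : ℝ) : Set Plane := Metric.ball 0 R

/-- The annulus of width `√2` around the circle of radius `R`. -/
def annulus (R : ℝ) : Set Plane :=
  {z | R - 1 / √2 < ‖z‖ ∧ ‖z‖ < R + 1 / √2}

/-- The integer pair `(m, n)` as a point of the plane. -/
def latticePoint (l : ℤ × ℤ) : Plane := !₂[(l.1 : ℝ), (l.2 : ℝ)]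

/-- The lattice points lying in the annulus around the circle of radius `R`. -/
def latticeAnnulus (R : ℝ) : Set (ℤ × ℤ) := {l | latticePoint l ∈ annulus R}

theorem latticeAnnulus_finite (R : ℝ) : (latticeAnnulus R).Finite := by
  obtain ⟨N, hN⟩ := exists_nat_gt (R + 1 / √2)
  refine (((Set.finite_Icc (-(N : ℤ)) N)).prod (Set.finite_Icc (-(N : ℤ)) N)).subset ?_
  rintro ⟨m, n⟩ ⟨-, h⟩
  have h1 := PiLp.norm_apply_le (latticePoint (m, n)) 0
  have h2 := PiLp.norm_apply_le (latticePoint (m, n)) 1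
  simp only [latticePoint, Real.norm_eq_abs, PiLp.toLp_apply, Matrix.cons_val_zero,
    Matrix.cons_val_one] at h1 h2 h
  have k1 : |(m : ℝ)| ≤ N := by linarith
  have k2 : |(n : ℝ)| ≤ N := by linarith
  rw [abs_le] at k1 k2
  simp only [Set.mem_prod, Set.mem_Icc]
  exact ⟨⟨by exact_mod_cast k1.1, by exact_mod_cast k1.2⟩,
    ⟨by exact_mod_cast k2.1, by exact_mod_cast k2.2⟩⟩

/-- `Γ_R`, the finite set of lattice points in the annulus. -/
def Gam (R : ℝ) : Finset (ℤ × ℤ) := (latticeAnnulus_finite R).toFinset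

/-- `K(R)`, the number of lattice points in the annulus. -/
def K (R : ℝ) : ℕ := (Gam R).card

/-- The closed unit square `[-1/2, 1/2]²`. -/
def unitSquare : Set Plane := {x | ∀ i, x i ∈ Set.Icc (-(1 / 2) : ℝ) (1 / 2)}

/-- The unit square `S(p) = S + p` centred at `p`. -/
def squareAt (p : Plane) : Set Plane := {x | x - p ∈ unitSquare}

/-- `A_R(l) = Area(S(l) ∩ B(R))`. -/
def area (R : ℝ) (l : ℤ × ℤ) : ℝ :=
  volume.real (squareAt (latticePoint l) ∩ disc R)

/-- The mean of the numbers `A_R(l)`, `l ∈ Γ_R`, counted with multiplicity. -/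
def mean (R : ℝ) : ℝ := (1 / (K R : ℝ)) * ∑ l ∈ Gam R, area R l

/-- The variance of the numbers `A_R(l)`, `l ∈ Γ_R`, counted with multiplicity. -/
def variance (R : ℝ) : ℝ := (1 / (K R : ℝ)) * ∑ l ∈ Gam R, (area R l - mean R) ^ 2

/-- The explicit limiting variance. -/
def c₀ : ℝ :=
  1 / 4 - 1 / (2 * Real.pi * √2) *
    (4 / 15 + 2 * Real.log (1 + √2) / 3 + 2 * √2 / 15)

end GaussCircle

end

/-! The unit squares at lattice points tile the plane, and a square whose centre lies outside the
annulus is covered completely (up to a null set) or not at all. Hence `K R` is a difference of two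
lattice point counts, at radii `R ± 1/√2`, and the sum of the areas over `Gam R` is `πR²` minus the
inner count (`K_add_card`, `sum_area_add_card`). If the counts are `πr² + O(r^(2/3))`, then `K R =
2√2πR + O(R^(2/3))` and the areas sum to `K R / 2 + O(R^(2/3))`; dividing gives (i).

The exponent `2/3` is the classical theorem of Voronoi, Sierpiński and van der Corput, obtained here
from exponential sums. The function "indicator of the disc minus covered area" lives on the annulus
and is invariant under quarter turns, so only the columns `|m| ≤ M`, with `M` near `R/√2`, of one
cone matter (`abs_sum_box_sub_columns_le`). Such a column contributes minus the sawtooth of `√(R² -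
m²)`, up to `O(1/R)`. Van der Corput's second derivative test and a Fourier series bound the sum of
these sawtooths (`abs_sum_saw_hgt_le`), uniformly in shifts and in truncation of the sum.

For (ii), expanding the square gives `V = E - E² - (1/K) ∑ A(1 - A)`, where the sum again splits
into columns. Inside a column the arc is within `O(1/R)` of its tangent, so the column sum is nearly
a function of the slope `τ = m/√(R² - m²)` and the fractional part of `√(R² - m²)`. The same uniform
sawtooth bound shows that the fractional parts are equidistributed against slowly varying weights
(`abs_sum_fract_sub_sum_integral_le`), so the column sum may be replaced by its mean over all
heights, `1/6 + τ²/12 - τ³/60` (`integral_spreadSum`). The sum over columns is then a Riemann sum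
with an elementary primitive (`hasDerivAt_spreadPrimitive`), which yields the limit `c₀`. -/

namespace GaussCircle

/-! ### Exponential sums: the Kusmin–Landau inequality -/

/-- The additive character `x ↦ exp (2πix)`. -/
noncomputable def expi (x : ℝ) : ℂ := Complex.exp ((2 * Real.pi * x : ℝ) * Complex.I)

theorem norm_expi (x : ℝ) : ‖expi x‖ = 1 := Complex.norm_exp_ofReal_mul_I _

theorem expi_add (x y : ℝ) : expi (x + y) = expi x * expi y := by
  rw [expi, expi, expi, ← Complex.exp_add]; congr 1; push_cast; ring

theorem expi_int (n : ℤ) : expi n = 1 := by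
  rw [expi, Complex.exp_eq_one_iff]
  exact ⟨n, by push_cast; ring⟩

theorem expi_eq (x : ℝ) :
    expi x = (Real.cos (2 * Real.pi * x) : ℝ) + (Real.sin (2 * Real.pi * x) : ℝ) * Complex.I := by
  rw [expi, Complex.exp_mul_I, Complex.ofReal_cos, Complex.ofReal_sin]

theorem expi_neg (x : ℝ) : expi (-x) = (starRingEnd ℂ) (expi x) := by
  rw [expi_eq, expi_eq, mul_neg, Real.cos_neg, Real.sin_neg, map_add, map_mul, Complex.conj_ofReal,
    Complex.conj_ofReal, Complex.conj_I]
  push_cast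
  ring

theorem norm_sum_expi_le (s : Finset ℕ) (x : ℕ → ℝ) : ‖∑ i ∈ s, expi (x i)‖ ≤ s.card := by
  refine (norm_sum_le _ _).trans ?_
  simp [norm_expi]

theorem norm_sum_expi_neg (s : Finset ℕ) (x : ℕ → ℝ) :
    ‖∑ i ∈ s, expi (-x i)‖ = ‖∑ i ∈ s, expi (x i)‖ := by
  simp_rw [expi_neg]
  rw [← map_sum, RCLike.norm_conj]

theorem norm_sum_expi_sub_const (s : Finset ℕ) (x : ℕ → ℝ) (c : ℝ) :
    ‖∑ i ∈ s, expi (x i - c)‖ = ‖∑ i ∈ s, expi (x i)‖ := by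
  simp_rw [sub_eq_add_neg, expi_add]
  rw [← Finset.sum_mul, norm_mul, norm_expi, mul_one]

/-- The cotangent of `πt`. -/
noncomputable def cotpi (t : ℝ) : ℝ := Real.cos (Real.pi * t) / Real.sin (Real.pi * t)

/-- `1 / (1 - expi t)` for nonintegral `t`. -/
noncomputable def invOneSubExpi (t : ℝ) : ℂ := 1 / 2 + (cotpi t / 2 : ℝ) * Complex.I

theorem two_mul_le_sin {t θ : ℝ} (hθ : 0 < θ) (h1 : θ ≤ t) (h2 : t ≤ 1 - θ) :
    2 * θ ≤ Real.sin (Real.pi * t) := by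
  have hp := Real.pi_pos
  have key : ∀ s, 0 ≤ s → s ≤ 1 / 2 → 2 * s ≤ Real.sin (Real.pi * s) := by
    intro s h0 hs
    have := Real.mul_le_sin (x := Real.pi * s) (by positivity) (by nlinarith)
    calc 2 * s = 2 / Real.pi * (Real.pi * s) := by field_simp
      _ ≤ _ := this
  rcases le_total t (1 / 2) with h | h
  · linarith [key t (by linarith) h]
  · have := key (1 - t) (by linarith) (by linarith)
    rw [mul_sub Real.pi, mul_one, Real.sin_pi_sub] at this
    linarith

theorem expi_eq_half (t : ℝ) :
    expi t = ((1 - 2 * (Real.sin (Real.pi * t) * Real.sin (Real.pi * t)) : ℝ) : ℂ) +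
      ((2 * Real.sin (Real.pi * t) * Real.cos (Real.pi * t) : ℝ) : ℂ) * Complex.I := by
  rw [expi_eq, mul_assoc 2, Real.sin_two_mul, Real.cos_two_mul, Real.cos_sq',
    show 2 * (1 - Real.sin (Real.pi * t) ^ 2) - 1 =
      1 - 2 * (Real.sin (Real.pi * t) * Real.sin (Real.pi * t)) by ring, mul_assoc 2 (Real.sin _)]

/-- `1 / (1 - expi t)` has constant real part `1/2`; all its variation sits in the cotangent, which
is monotone on a period. This is what makes the partial summation in Kusmin–Landau telescope. -/
theorem one_sub_expi_mul {t : ℝ} (h : Real.sin (Real.pi * t) ≠ 0) :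
    (1 - expi t) * invOneSubExpi t = 1 := by
  rw [expi_eq_half, invOneSubExpi, cotpi]
  set s := Real.sin (Real.pi * t)
  set c := Real.cos (Real.pi * t)
  have hsc : s ^ 2 + c ^ 2 = 1 := Real.sin_sq_add_cos_sq _
  have hs : (s : ℂ) ≠ 0 := by exact_mod_cast h
  apply Complex.ext
  · simp
    field_simp
    nlinarith
  · simp
    field_simp
    ring

theorem norm_invOneSubExpi {t : ℝ} (h : 0 < Real.sin (Real.pi * t)) :
    ‖invOneSubExpi t‖ = 1 / (2 * Real.sin (Real.pi * t)) := by
  have h2 := congrArg (fun z => ‖z‖) (one_sub_expi_mul h.ne')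
  have h3 : ‖1 - expi t‖ = 2 * Real.sin (Real.pi * t) := by
    rw [expi_eq_half, Complex.norm_def, Complex.normSq_apply]
    set s := Real.sin (Real.pi * t)
    set c := Real.cos (Real.pi * t)
    have hsc : s ^ 2 + c ^ 2 = 1 := Real.sin_sq_add_cos_sq _
    rw [Real.sqrt_eq_iff_mul_self_eq_of_pos (by positivity)]
    simp
    linear_combination (-4 * s ^ 2) * hsc
  simp only [norm_mul, norm_one, h3] at h2
  field_simp
  linarith

theorem cotpi_sub {s t : ℝ} (hs : 0 < Real.sin (Real.pi * s)) (ht : 0 < Real.sin (Real.pi * t)) :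
    cotpi s - cotpi t =
      Real.sin (Real.pi * (t - s)) / (Real.sin (Real.pi * s) * Real.sin (Real.pi * t)) := by
  rw [cotpi, cotpi, mul_sub, Real.sin_sub]
  field_simp

theorem norm_invOneSubExpi_sub (s t : ℝ) :
    ‖invOneSubExpi s - invOneSubExpi t‖ = |cotpi s - cotpi t| / 2 := by
  have : invOneSubExpi s - invOneSubExpi t = (((cotpi s - cotpi t) / 2 : ℝ) : ℂ) * Complex.I := by
    rw [invOneSubExpi, invOneSubExpi]; push_cast; ring
  rw [this, norm_mul, Complex.norm_I, mul_one, Complex.norm_real, Real.norm_eq_abs, abs_div]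
  simp

/-- The Kusmin–Landau inequality for sequences with monotone differences. -/
theorem norm_sum_expi_le_of_differences {x : ℕ → ℝ} {n : ℕ} {θ : ℝ} (hθ : 0 < θ)
    (h1 : ∀ i < n, θ ≤ x (i + 1) - x i) (h2 : ∀ i < n, x (i + 1) - x i ≤ 1 - θ)
    (h3 : ∀ i, i + 1 < n → x (i + 1) - x i ≤ x (i + 2) - x (i + 1)) :
    ‖∑ i ∈ Finset.range n, expi (x i)‖ ≤ 1 / θ := by
  set d : ℕ → ℝ := fun i => x (i + 1) - x i with hd
  have hsin : ∀ i < n, 2 * θ ≤ Real.sin (Real.pi * d i) := fun i hi =>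
    two_mul_le_sin hθ (h1 i hi) (h2 i hi)
  have hg : ∀ i < n, ‖invOneSubExpi (d i)‖ ≤ 1 / (4 * θ) := by
    intro i hi
    have := hsin i hi
    rw [norm_invOneSubExpi (by linarith)]
    exact one_div_le_one_div_of_le (by linarith) (by linarith)
  have hc : ∀ i < n, |cotpi (d i)| ≤ 1 / (2 * θ) := by
    intro i hi
    have := hsin i hi
    rw [cotpi, abs_div, abs_of_pos (show 0 < Real.sin (Real.pi * d i) by linarith)]
    exact div_le_div₀ zero_le_one (Real.abs_cos_le_one _) (by linarith) this
  -- Each term is a difference of consecutive exponentials times a slowly varying factor, ready for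
  -- summation by parts.
  have hz : ∀ i < n, expi (x i) = (expi (x i) - expi (x (i + 1))) * invOneSubExpi (d i) := by
    intro i hi
    have e : expi (x (i + 1)) = expi (x i) * expi (d i) := by
      rw [← expi_add]; congr 1; simp [hd]
    have := one_sub_expi_mul (t := d i) (by have := hsin i hi; linarith)
    rw [e]
    linear_combination (-expi (x i)) * this
  -- Summation by parts as an induction: the boundary term stays on the left, and since the
  -- differences increase, the cotangents decrease and their variation telescopes.
  have main : ∀ k, k + 1 ≤ n →
      ‖∑ i ∈ Finset.range (k + 1), expi (x i) + expi (x (k + 1)) * invOneSubExpi (d k)‖ ≤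
        ‖invOneSubExpi (d 0)‖ + (cotpi (d 0) - cotpi (d k)) / 2 := by
    intro k
    induction k with
    | zero =>
      intro hk
      rw [zero_add, Finset.sum_range_one]
      nth_rewrite 1 [hz 0 (by omega)]
      rw [zero_add, ← add_mul, sub_add_cancel, norm_mul, norm_expi]
      simp
    | succ k ih =>
      intro hk
      have e1 := hsin k (by omega)
      have e2 := hsin (k + 1) (by omega)
      have hcs : 0 ≤ cotpi (d k) - cotpi (d (k + 1)) := by
        rw [cotpi_sub (by linarith) (by linarith)]
        apply div_nonneg
        · have a1 := h3 k (by omega)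
          have a2 := h1 k (by omega)
          have a3 := h2 (k + 1) (by omega)
          have a4 : d (k + 1) = x (k + 2) - x (k + 1) := rfl
          have a5 : d k = x (k + 1) - x k := rfl
          apply Real.sin_nonneg_of_nonneg_of_le_pi
          · exact mul_nonneg Real.pi_pos.le (by rw [a4, a5]; linarith)
          · have : d (k + 1) - d k ≤ 1 := by
              have : d (k + 1) ≤ 1 - θ := a3
              have : θ ≤ d k := a2
              linarith
            nlinarith [Real.pi_pos]
        · exact mul_nonneg (by linarith) (by linarith)
      rw [Finset.sum_range_succ]
      have e : ∑ i ∈ Finset.range (k + 1), expi (x i) + expi (x (k + 1)) +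
            expi (x (k + 1 + 1)) * invOneSubExpi (d (k + 1)) =
          (∑ i ∈ Finset.range (k + 1), expi (x i) + expi (x (k + 1)) * invOneSubExpi (d k)) +
            expi (x (k + 1)) * (invOneSubExpi (d (k + 1)) - invOneSubExpi (d k)) := by
        linear_combination hz (k + 1) (by omega)
      rw [e]
      refine (norm_add_le _ _).trans ?_
      rw [norm_mul, norm_expi, one_mul, norm_invOneSubExpi_sub, abs_sub_comm, abs_of_nonneg hcs]
      have := ih (by omega)
      linarith
  rcases n with _ | n
  · simp only [Finset.range_zero, Finset.sum_empty, norm_zero]; positivity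
  have m1 := main n le_rfl
  have m2 := hg 0 (by omega)
  have m3 := hg n (by omega)
  have m4 := abs_le.1 (hc 0 (by omega))
  have m5 := abs_le.1 (hc n (by omega))
  have m6 : ‖∑ i ∈ Finset.range (n + 1), expi (x i)‖ ≤
      ‖∑ i ∈ Finset.range (n + 1), expi (x i) + expi (x (n + 1)) * invOneSubExpi (d n)‖ +
      ‖invOneSubExpi (d n)‖ := by
    have := norm_sub_le (∑ i ∈ Finset.range (n + 1), expi (x i) +
      expi (x (n + 1)) * invOneSubExpi (d n)) (expi (x (n + 1)) * invOneSubExpi (d n))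
    rwa [add_sub_cancel_right, norm_mul (expi _), norm_expi, one_mul] at this
  have e1 : 1 / (4 * θ) = 1 / θ / 4 := by field_simp
  have e2 : 1 / (2 * θ) = 1 / θ / 2 := by field_simp
  rw [e1] at m2 m3
  rw [e2] at m4 m5
  linarith

/-! ### Van der Corput's second derivative test -/

section VanDerCorput

variable {x : ℕ → ℝ} {N : ℕ} {lam c : ℝ}

theorem difference_growth
    (h1 : ∀ i, i + 1 < N → x (i + 1) - x i + lam ≤ x (i + 2) - x (i + 1)) (a k : ℕ)
    (hk : a + k < N) :
    x (a + 1) - x a + k * lam ≤ x (a + k + 1) - x (a + k) := by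
  induction k with
  | zero => simp
  | succ k ih =>
    have a1 := ih (by omega)
    have a2 := h1 (a + k) (by omega)
    rw [show a + (k + 1) = a + k + 1 by ring, show a + k + 1 + 1 = a + k + 2 by ring]
    push_cast
    linarith

theorem difference_growth_le
    (h1 : ∀ i, i + 1 < N → x (i + 2) - x (i + 1) ≤ x (i + 1) - x i + c * lam) (k : ℕ)
    (hk : k < N) :
    x (k + 1) - x k ≤ x 1 - x 0 + k * (c * lam) := by
  induction k with
  | zero => simp
  | succ k ih =>
    have a1 := ih (by omega)
    have a2 := h1 k (by omega)
    push_cast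
    linarith

/-- Between the first and the last index of `s` the differences grow by at least `lam` per step, yet
by at most `θ` in all. -/
theorem card_difference_mem_le (hl : 0 < lam)
    (h1 : ∀ i, i + 1 < N → x (i + 1) - x i + lam ≤ x (i + 2) - x (i + 1))
    {θ p : ℝ} (hθ : 0 ≤ θ) (s : Finset ℕ)
    (hs : ∀ i ∈ s, i < N ∧ p ≤ x (i + 1) - x i ∧ x (i + 1) - x i ≤ p + θ) :
    (s.card : ℝ) ≤ θ / lam + 1 := by
  rcases s.eq_empty_or_nonempty with rfl | hne
  · simp only [Finset.card_empty, Nat.cast_zero]; positivity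
  set a := s.min' hne
  set b := s.max' hne
  have hab : a ≤ b := s.min'_le_max' hne
  obtain ⟨k, hk⟩ := Nat.exists_eq_add_of_le hab
  have ha := hs a (s.min'_mem hne)
  have hb := hs b (s.max'_mem hne)
  have hsub : s ⊆ Finset.Icc a b := fun i hi =>
    Finset.mem_Icc.2 ⟨s.min'_le i hi, s.le_max' i hi⟩
  have hc := Finset.card_le_card hsub
  rw [Nat.card_Icc, hk] at hc
  have hc' : s.card ≤ k + 1 := by omega
  have g := difference_growth h1 a k (by omega)
  rw [hk] at hb
  have : (k : ℝ) ≤ θ / lam := by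
    rw [le_div_iff₀ hl]; linarith
  have : (s.card : ℝ) ≤ k + 1 := by exact_mod_cast hc'
  linarith

/-- Monotone differences make the index set an interval. Subtracting the integer `j * i` from the
phase leaves the exponentials unchanged and moves the differences into `[θ, 1 - θ]`, where
Kusmin–Landau applies. -/
theorem norm_sum_expi_middle_le (hl : 0 ≤ lam)
    (h1 : ∀ i, i + 1 < N → x (i + 1) - x i + lam ≤ x (i + 2) - x (i + 1))
    {θ : ℝ} (hθ : 0 < θ) (j : ℤ) (s : Finset ℕ)
    (hs : ∀ i, i ∈ s ↔ i < N ∧ j + θ ≤ x (i + 1) - x i ∧ x (i + 1) - x i ≤ j + (1 - θ)) :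
    ‖∑ i ∈ s, expi (x i)‖ ≤ 1 / θ := by
  rcases s.eq_empty_or_nonempty with rfl | hne
  · simp only [Finset.sum_empty, norm_zero]; positivity
  set a := s.min' hne
  set b := s.max' hne
  have hab : a ≤ b := s.min'_le_max' hne
  obtain ⟨k, hk⟩ := Nat.exists_eq_add_of_le hab
  have ha := (hs a).1 (s.min'_mem hne)
  have hb := (hs b).1 (s.max'_mem hne)
  have mono : ∀ u v, u ≤ v → v < N → x (u + 1) - x u ≤ x (v + 1) - x v := by
    intro u v huv hv
    obtain ⟨k, rfl⟩ := Nat.exists_eq_add_of_le huv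
    have := difference_growth h1 u k hv
    have : 0 ≤ k * lam := by positivity
    linarith
  have hse : s = Finset.Ico a (a + (k + 1)) := by
    ext i
    constructor
    · intro hi
      have e1 := s.min'_le i hi
      have e2 := s.le_max' i hi
      exact Finset.mem_Ico.2 ⟨e1, by omega⟩
    · intro hi
      obtain ⟨e1, e2⟩ := Finset.mem_Ico.1 hi
      have hib : i ≤ b := by omega
      have := mono a i e1 (by omega)
      have := mono i b hib hb.1
      exact (hs i).2 ⟨by omega, by linarith, by linarith⟩
  have hmem : ∀ i < k + 1, a + i ∈ s := fun i hi => by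
    rw [hse, Finset.mem_Ico]; omega
  have hsum : ∑ i ∈ s, expi (x i) =
      ∑ i ∈ Finset.range (k + 1), expi (x (a + i) - j * i) := by
    rw [hse, Finset.sum_Ico_eq_sum_range]
    simp only [add_tsub_cancel_left]
    refine Finset.sum_congr rfl fun i _ => ?_
    have : x (a + i) - j * i = x (a + i) + ((-(j * i) : ℤ) : ℝ) := by push_cast; ring
    rw [this, expi_add, expi_int, mul_one]
  rw [hsum]
  apply norm_sum_expi_le_of_differences hθ
  · intro i hi
    have := ((hs _).1 (hmem i hi)).2.1
    rw [← add_assoc]; push_cast; linarith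
  · intro i hi
    have := ((hs _).1 (hmem i hi)).2.2
    rw [← add_assoc]; push_cast; linarith
  · intro i hi
    have := h1 (a + i) (by have := ((hs _).1 (hmem (i + 1) hi)).1; omega)
    rw [← add_assoc, ← add_assoc]; push_cast; linarith

/-- Indices whose difference is within `θ` of an integer are counted trivially, about `θ / lam` at
each end; the others cost `1 / θ`. The choice `θ = √lam / 2` balances the two. -/
theorem norm_sum_expi_floor_fiber_le (hl : 0 < lam) (hl1 : lam ≤ 1)
    (h1 : ∀ i, i + 1 < N → x (i + 1) - x i + lam ≤ x (i + 2) - x (i + 1)) (j : ℤ) :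
    ‖∑ i ∈ Finset.range N with ⌊x (i + 1) - x i⌋ = j, expi (x i)‖ ≤ 5 / √lam := by
  set r := √lam with hr
  have hr0 : 0 < r := Real.sqrt_pos.2 hl
  have hrr : r * r = lam := Real.mul_self_sqrt hl.le
  have hr1 : r ≤ 1 := Real.sqrt_le_one.2 hl1
  set s := (Finset.range N).filter (fun i => ⌊x (i + 1) - x i⌋ = j) with hs
  have hmem : ∀ i, i ∈ s ↔ i < N ∧ (j : ℝ) ≤ x (i + 1) - x i ∧ x (i + 1) - x i < j + 1 := by
    intro i
    rw [hs, Finset.mem_filter, Finset.mem_range, Int.floor_eq_iff]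
  set θ := r / 2 with hθ
  have hθ0 : 0 < θ := by positivity
  rw [← Finset.sum_filter_add_sum_filter_not s
    (fun i => j + θ ≤ x (i + 1) - x i ∧ x (i + 1) - x i ≤ j + (1 - θ))]
  rw [← Finset.sum_filter_add_sum_filter_not 
    (s.filter (fun i => ¬(j + θ ≤ x (i + 1) - x i ∧ x (i + 1) - x i ≤ j + (1 - θ))))
    (fun i => x (i + 1) - x i ≤ j + θ)]
  have hA := norm_sum_expi_middle_le hl.le h1 hθ0 j
    (s.filter (fun i => j + θ ≤ x (i + 1) - x i ∧ x (i + 1) - x i ≤ j + (1 - θ))) (by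
      intro i
      rw [Finset.mem_filter, hmem]
      constructor
      · rintro ⟨⟨a, _, _⟩, b, c⟩; exact ⟨a, b, c⟩
      · rintro ⟨a, b, c⟩; exact ⟨⟨a, by linarith, by linarith⟩, b, c⟩)
  have hB := (norm_sum_expi_le ((s.filter (fun i => ¬(j + θ ≤ x (i + 1) - x i ∧
      x (i + 1) - x i ≤ j + (1 - θ)))).filter (fun i => x (i + 1) - x i ≤ j + θ)) x).trans
    (card_difference_mem_le (p := j) hl h1 hθ0.le _ (by
      intro i hi
      rw [Finset.mem_filter, Finset.mem_filter, hmem] at hi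
      exact ⟨hi.1.1.1, hi.1.1.2.1, hi.2⟩))
  have hC := (norm_sum_expi_le ((s.filter (fun i => ¬(j + θ ≤ x (i + 1) - x i ∧
      x (i + 1) - x i ≤ j + (1 - θ)))).filter (fun i => ¬ x (i + 1) - x i ≤ j + θ)) x).trans
    (card_difference_mem_le (p := j + (1 - θ)) hl h1 hθ0.le _ (by
      intro i hi
      rw [Finset.mem_filter, Finset.mem_filter, hmem] at hi
      obtain ⟨⟨⟨a, b, c⟩, d⟩, e⟩ := hi
      push Not at d e
      exact ⟨a, (d e.le).le, by linarith⟩))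
  have t1 : θ / lam = 1 / r / 2 := by rw [← hrr, hθ]; field_simp
  have t2 : 1 / θ = 2 * (1 / r) := by rw [hθ]; field_simp
  have t3 : 1 ≤ 1 / r := by rw [le_div_iff₀ hr0]; linarith
  have t4 : 5 / r = 5 * (1 / r) := by ring
  rw [t1] at hB hC
  rw [t2] at hA
  rw [t4]
  refine (norm_add_le _ _).trans ?_
  have := norm_add_le
    (∑ i ∈ (s.filter (fun i => ¬(j + θ ≤ x (i + 1) - x i ∧
      x (i + 1) - x i ≤ j + (1 - θ)))).filter (fun i => x (i + 1) - x i ≤ j + θ), expi (x i))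
    (∑ i ∈ (s.filter (fun i => ¬(j + θ ≤ x (i + 1) - x i ∧
      x (i + 1) - x i ≤ j + (1 - θ)))).filter (fun i => ¬ x (i + 1) - x i ≤ j + θ), expi (x i))
  linarith

/-- Van der Corput's second derivative test, for second differences. -/
theorem norm_sum_expi_le_of_second_differences (hl : 0 < lam) (hl1 : lam ≤ 1) (hc : 0 ≤ c)
    (h1 : ∀ i, i + 1 < N → x (i + 1) - x i + lam ≤ x (i + 2) - x (i + 1))
    (h2 : ∀ i, i + 1 < N → x (i + 2) - x (i + 1) ≤ x (i + 1) - x i + c * lam) :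
    ‖∑ i ∈ Finset.range N, expi (x i)‖ ≤ 5 * c * N * √lam + 10 / √lam := by
  set r := √lam with hr
  have hr0 : 0 < r := Real.sqrt_pos.2 hl
  have hrr : r * r = lam := Real.mul_self_sqrt hl.le
  rcases N with _ | N
  · simp only [Finset.range_zero, Finset.sum_empty, norm_zero]; positivity
  set lo := ⌊x 1 - x 0⌋
  set hi := ⌊x (N + 1) - x N⌋
  have hmaps : ∀ i ∈ Finset.range (N + 1), ⌊x (i + 1) - x i⌋ ∈ Finset.Icc lo hi := by
    intro i hi
    have hi' : i < N + 1 := Finset.mem_range.1 hi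
    rw [Finset.mem_Icc]
    constructor
    · apply Int.floor_le_floor
      have := difference_growth h1 0 i (by omega)
      have : 0 ≤ i * lam := by positivity
      simp only [zero_add] at *
      linarith
    · apply Int.floor_le_floor
      obtain ⟨k, hk⟩ := Nat.exists_eq_add_of_le (show i ≤ N by omega)
      have := difference_growth h1 i k (by omega)
      have : 0 ≤ k * lam := by positivity
      rw [hk]
      linarith
  rw [← Finset.sum_fiberwise_of_maps_to hmaps]
  refine (norm_sum_le _ _).trans ?_
  refine (Finset.sum_le_sum fun j _ => norm_sum_expi_floor_fiber_le hl hl1 h1 j).trans ?_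
  rw [Finset.sum_const, nsmul_eq_mul, Int.card_Icc]
  have hlohi : lo ≤ hi := by
    have := Finset.mem_Icc.1 (hmaps 0 (by simp))
    exact this.1.trans this.2
  -- The differences drift by at most `N * (c * lam)` in total, so this bounds the number of integer
  -- parts they meet, up to the two ends.
  have hcard : (((hi + 1 - lo).toNat : ℕ) : ℝ) ≤ N * (c * lam) + 2 := by
    have e : (((hi + 1 - lo).toNat : ℤ) : ℝ) = hi + 1 - lo := by
      rw [Int.toNat_of_nonneg (by omega)]; push_cast; ring
    rw [Int.cast_natCast] at e
    rw [e]
    have a1 := difference_growth_le h2 N (by omega)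
    have a2 := Int.floor_le (x (N + 1) - x N)
    have a3 := Int.lt_floor_add_one (x 1 - x 0)
    change (hi : ℝ) ≤ _ at a2
    change _ < (lo : ℝ) + 1 at a3
    linarith
  calc (((hi + 1 - lo).toNat : ℕ) : ℝ) * (5 / r) ≤ (N * (c * lam) + 2) * (5 / r) := by gcongr
    _ = 5 * c * N * r + 10 / r := by
        rw [← hrr]
        field_simp
        ring
    _ ≤ _ := by push_cast; gcongr; linarith

end VanDerCorput

/-! ### Sawtooth sums from exponential sums -/

/-- The sawtooth function. -/
noncomputable def saw (x : ℝ) : ℝ := Int.fract x - 1 / 2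

/-- A periodic antiderivative of the sawtooth function. -/
noncomputable def sawInt (x : ℝ) : ℝ := (Int.fract x ^ 2 - Int.fract x) / 2

theorem fract_sub_eq_of_le {x d : ℝ} (hd : 0 ≤ d) (h : d ≤ Int.fract x) :
    Int.fract (x - d) = Int.fract x - d := by
  rw [Int.fract_eq_iff]
  refine ⟨by linarith, by linarith [Int.fract_lt_one x], ⌊x⌋, ?_⟩
  linarith [Int.self_sub_floor x]

theorem fract_sub_eq_of_lt {x d : ℝ} (hd : d ≤ 1) (h : Int.fract x < d) :
    Int.fract (x - d) = Int.fract x - d + 1 := by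
  rw [Int.fract_eq_iff]
  refine ⟨by linarith [Int.fract_nonneg x], by linarith, ⌊x⌋ - 1, ?_⟩
  push_cast
  linarith [Int.self_sub_floor x]

/-- The sawtooth rises with slope one and only jumps downwards, so it exceeds its mean over `[x - d,
x]` by at most `d`. The companion `le_saw` uses the mean over `[x, x + d]`. -/
theorem saw_le {x d : ℝ} (hd : 0 < d) (hd1 : d ≤ 1) :
    saw x ≤ d + (sawInt x - sawInt (x - d)) / d := by
  have h0 := Int.fract_nonneg x
  rw [saw, sawInt, sawInt, ← sub_le_iff_le_add', le_div_iff₀ hd]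
  rcases le_or_gt d (Int.fract x) with h | h
  · rw [fract_sub_eq_of_le hd.le h]; nlinarith
  · rw [fract_sub_eq_of_lt hd1 h]; nlinarith

theorem le_saw {x d : ℝ} (hd : 0 < d) (hd1 : d ≤ 1) :
    -d + (sawInt (x + d) - sawInt x) / d ≤ saw x := by
  have h0 := Int.fract_nonneg (x + d)
  have h1 := Int.fract_lt_one (x + d)
  obtain ⟨y, rfl⟩ : ∃ y, x = y - d := ⟨x + d, by ring⟩
  rw [sub_add_cancel] at *
  rw [saw, sawInt, sawInt, ← le_sub_iff_add_le', div_le_iff₀ hd]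
  rcases le_or_gt d (Int.fract y) with h | h
  · rw [fract_sub_eq_of_le hd.le h]; nlinarith
  · rw [fract_sub_eq_of_lt hd1 h]; nlinarith

/-- This is the Fourier series of the second Bernoulli polynomial. Its absolute convergence is the
reason for passing from `saw` to its antiderivative. -/
theorem hasSum_cos_sawInt (x : ℝ) :
    HasSum (fun n : ℕ => 1 / (n : ℝ) ^ 2 * Real.cos (2 * Real.pi * (n * x)))
      (Real.pi ^ 2 * (2 * sawInt x + 1 / 6)) := by
  have h := hasSum_one_div_nat_pow_mul_cos (k := 1) one_ne_zero (x := Int.fract x)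
    ⟨Int.fract_nonneg x, (Int.fract_lt_one x).le⟩
  convert! h using 1
  · ext n
    congr 1
    have : 2 * Real.pi * (n * x) =
        2 * Real.pi * n * Int.fract x + ((n * ⌊x⌋ : ℤ) : ℝ) * (2 * Real.pi) := by
      push_cast
      linear_combination (-(2 * Real.pi * n)) * (Int.fract_add_floor x)
    rw [this, Real.cos_add_int_mul_two_pi]
  · simp only [mul_one, sawInt]
    rw [Polynomial.bernoulli, Polynomial.eval_map]
    norm_num [Finset.sum_range_succ, bernoulli_two, Polynomial.eval₂_add]
    ring

theorem norm_one_sub_expi_le (t : ℝ) : ‖1 - expi t‖ ≤ 2 * Real.pi * |t| := by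
  have := Real.norm_exp_I_mul_ofReal_sub_one_le (x := 2 * Real.pi * t)
  rw [mul_comm Complex.I, Real.norm_eq_abs, abs_mul, abs_of_pos Real.two_pi_pos] at this
  rwa [norm_sub_rev]

theorem norm_one_sub_expi_le_two (t : ℝ) : ‖1 - expi t‖ ≤ 2 := by
  refine (norm_sub_le _ _).trans ?_
  rw [norm_one, norm_expi]; norm_num

theorem abs_sum_cos_sub_le (s : Finset ℕ) (x : ℕ → ℝ) (d : ℝ) (n : ℕ) :
    |∑ i ∈ s, (Real.cos (2 * Real.pi * (n * x i)) - Real.cos (2 * Real.pi * (n * (x i - d))))| ≤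
      ‖∑ i ∈ s, expi (n * x i)‖ * ‖1 - expi (-(n * d))‖ := by
  rw [← norm_mul]
  have : ∑ i ∈ s, (Real.cos (2 * Real.pi * (n * x i)) -
      Real.cos (2 * Real.pi * (n * (x i - d)))) =
      ((∑ i ∈ s, expi (n * x i)) * (1 - expi (-(n * d)))).re := by
    rw [Finset.sum_mul, Complex.re_sum]
    refine Finset.sum_congr rfl fun i _ => ?_
    rw [mul_sub (expi _), mul_one, ← expi_add, Complex.sub_re, expi_eq, expi_eq]
    simp only [Complex.add_re, Complex.ofReal_re, Complex.mul_re, Complex.ofReal_im, Complex.I_re,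
      Complex.I_im]
    ring_nf
  rw [this]
  exact Complex.abs_re_le_norm _

/-- Summed over `n`, the right side telescopes to at most `4 / κ`, replacing an integral comparison.
-/
theorem one_div_sqrt_mul_le_telescope {κ : ℝ} (hκ : 0 < κ) (n : ℕ) :
    1 / (√(n + 1 : ℝ) * ((n + 1 : ℝ) + κ ^ 2)) ≤
      4 * (1 / (√(n : ℝ) + κ) - 1 / (√(n + 1 : ℝ) + κ)) := by
  set a := √(n : ℝ)
  set b := √(n + 1 : ℝ)
  have ha : 0 ≤ a := Real.sqrt_nonneg _
  have hb : 0 < b := Real.sqrt_pos.2 (by positivity)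
  have haa : a ^ 2 = n := Real.sq_sqrt (by positivity)
  have hbb : b ^ 2 = n + 1 := Real.sq_sqrt (by positivity)
  have hab : a ≤ b := Real.sqrt_le_sqrt (by linarith)
  rw [← hbb, div_sub_div _ _ (by positivity) (by positivity), mul_div_assoc',
    div_le_div_iff₀ (by positivity) (by positivity)]
  have h1 : 1 ≤ 2 * b * (b - a) := by nlinarith
  have h2 : (a + κ) * (b + κ) ≤ 2 * (b ^ 2 + κ ^ 2) := by nlinarith [sq_nonneg (b - κ)]
  nlinarith [mul_le_mul_of_nonneg_right h1 (show 0 ≤ 2 * (b ^ 2 + κ ^ 2) by positivity)]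

/-- The `k`-th Fourier term is at most a constant times `k⁻² * (B * √k) * min 1 (k * d)`, and both
ranges `k < 1/d` and `k > 1/d` sum to order `B * √d`. The minimum is replaced by the smooth majorant
`k / (k + κ²)` with `κ² = 1/d`, which suits the telescoping bound. -/
theorem abs_sum_sawInt_sub_le {s : Finset ℕ} {x : ℕ → ℝ} {B d : ℝ} (hB0 : 0 ≤ B)
    (hB : ∀ k : ℕ, 1 ≤ k → ‖∑ i ∈ s, expi (k * x i)‖ ≤ B * √k) (hd : 0 < d) :
    |∑ i ∈ s, (sawInt (x i) - sawInt (x i - d))| ≤ 3 * B * √d := by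
  set u : ℕ → ℝ := fun n => 1 / (n : ℝ) ^ 2 * ∑ i ∈ s,
    (Real.cos (2 * Real.pi * (n * x i)) - Real.cos (2 * Real.pi * (n * (x i - d)))) with hu
  have hpi := Real.pi_pos
  have hsum : HasSum u (2 * Real.pi ^ 2 * ∑ i ∈ s, (sawInt (x i) - sawInt (x i - d))) := by
    have h := hasSum_sum (s := s) (fun i _ =>
      (hasSum_cos_sawInt (x i)).sub (hasSum_cos_sawInt (x i - d)))
    convert! h using 1
    · ext n
      simp only [hu, Finset.mul_sum, mul_sub]
    · rw [Finset.mul_sum]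
      exact Finset.sum_congr rfl fun i _ => by ring
  set κ := 1 / √d
  have hsd : 0 < √d := Real.sqrt_pos.2 hd
  have hκ : 0 < κ := by positivity
  have hκd : κ ^ 2 * d = 1 := by
    simp only [κ, div_pow, one_pow, Real.sq_sqrt hd.le]; field_simp
  have hun : ∀ n : ℕ, |u (n + 1)| ≤
      16 * Real.pi * B * (1 / (√(n : ℝ) + κ) - 1 / (√(n + 1 : ℝ) + κ)) := by
    intro n
    have h1 := abs_sum_cos_sub_le s x d (n + 1)
    have h2 := hB (n + 1) (by omega)
    have h3 := norm_one_sub_expi_le (-(((n + 1 : ℕ) : ℝ) * d))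
    have h4 := norm_one_sub_expi_le_two (-(((n + 1 : ℕ) : ℝ) * d))
    have h5 := one_div_sqrt_mul_le_telescope hκ n
    simp only [hu, abs_mul]
    rw [abs_of_nonneg (by positivity)]
    rw [abs_neg, abs_of_nonneg (by positivity)] at h3
    push_cast at h1 h2 h3 h4 ⊢
    set m : ℝ := (n : ℝ) + 1
    have hm : 1 ≤ m := by simp [m]
    set b := √m
    have hb : 0 < b := Real.sqrt_pos.2 (by linarith)
    have hbb : b ^ 2 = m := Real.sq_sqrt (by linarith)
    set w := ‖1 - expi (-(m * d))‖
    have hw : w * (m + κ ^ 2) ≤ 4 * Real.pi * m := by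
      have h6 : w * κ ^ 2 ≤ 2 * Real.pi * m := by
        calc w * κ ^ 2 ≤ (2 * Real.pi * (m * d)) * κ ^ 2 := by gcongr
          _ = 2 * Real.pi * m * (κ ^ 2 * d) := by ring
          _ = _ := by rw [hκd, mul_one]
      have h7 : w * m ≤ 2 * Real.pi * m := by
        have := Real.pi_gt_three
        have : w ≤ 2 * Real.pi := by linarith
        gcongr
      linarith
    calc 1 / m ^ 2 * _ ≤ 1 / m ^ 2 * (B * b * w) := by
          gcongr
          exact h1.trans (by gcongr)
      _ = B * (w * (m + κ ^ 2)) * (b / (m ^ 2 * (m + κ ^ 2))) := by field_simp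
      _ ≤ B * (4 * Real.pi * m) * (b / (m ^ 2 * (m + κ ^ 2))) := by gcongr
      _ = 4 * Real.pi * B * (1 / (b * (m + κ ^ 2))) := by
          rw [← hbb]; field_simp
      _ ≤ 4 * Real.pi * B * (4 * (1 / (√(n : ℝ) + κ) - 1 / (b + κ))) := by gcongr
      _ = _ := by ring
  have hpart : ∀ k : ℕ, |∑ n ∈ Finset.range (k + 1), u n| ≤
      16 * Real.pi * B * (1 / κ - 1 / (√(k : ℝ) + κ)) := by
    intro k
    induction k with
    | zero => simp [hu]
    | succ k ih =>
      rw [Finset.sum_range_succ]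
      refine (abs_add_le _ _).trans ?_
      have := hun k
      push_cast
      linarith
  have hlim := (hsum.tendsto_sum_nat.comp (tendsto_add_atTop_nat 1)).abs
  have hfin : |2 * Real.pi ^ 2 * ∑ i ∈ s, (sawInt (x i) - sawInt (x i - d))| ≤
      16 * Real.pi * B * (1 / κ) := by
    refine le_of_tendsto' hlim fun k => (hpart k).trans ?_
    have : 0 ≤ 1 / (√(k : ℝ) + κ) := by positivity
    gcongr
    linarith
  have hk : 1 / κ = √d := by simp [κ]
  rw [hk, abs_mul, abs_of_pos (by positivity)] at hfin
  have h8 : Real.pi * |∑ i ∈ s, (sawInt (x i) - sawInt (x i - d))| ≤ 8 * B * √d := by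
    have : 2 * Real.pi * (Real.pi * |∑ i ∈ s, (sawInt (x i) - sawInt (x i - d))|) ≤
        2 * Real.pi * (8 * B * √d) := by linarith
    exact le_of_mul_le_mul_left this (by positivity)
  have h9 : 0 ≤ B * √d := by positivity
  nlinarith [Real.pi_gt_three, abs_nonneg (∑ i ∈ s, (sawInt (x i) - sawInt (x i - d)))]

/-- A bound for sums of the sawtooth function in terms of exponential sums. -/
theorem abs_sum_saw_le {s : Finset ℕ} {x : ℕ → ℝ} {B d : ℝ} (hB0 : 0 ≤ B)
    (hB : ∀ k : ℕ, 1 ≤ k → ‖∑ i ∈ s, expi (k * x i)‖ ≤ B * √k) (hd : 0 < d) (hd1 : d ≤ 1) :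
    |∑ i ∈ s, saw (x i)| ≤ s.card * d + 3 * B / √d := by
  have hsd : 0 < √d := Real.sqrt_pos.2 hd
  have hdd : √d * √d = d := Real.mul_self_sqrt hd.le
  have e : 3 * B * √d / d = 3 * B / √d := by
    rw [div_eq_div_iff hd.ne' hsd.ne', mul_assoc, hdd]
  rw [abs_le]
  constructor
  -- A shift by `d` multiplies the `k`-th exponential sum by a unimodular constant, so the same `B`
  -- serves.
  · have hB' : ∀ k : ℕ, 1 ≤ k → ‖∑ i ∈ s, expi (k * (x i + d))‖ ≤ B * √k := by
      intro k hk
      have := norm_sum_expi_sub_const s (fun i => k * x i) (-(k * d))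
      simp only [sub_neg_eq_add, ← mul_add] at this
      rw [this]
      exact hB k hk
    have h1 := (abs_le.1 (abs_sum_sawInt_sub_le hB0 hB' hd)).1
    have h2 : ∑ i ∈ s, (-d + (sawInt (x i + d) - sawInt (x i)) / d) ≤ ∑ i ∈ s, saw (x i) :=
      Finset.sum_le_sum fun i _ => le_saw hd hd1
    rw [Finset.sum_add_distrib, ← Finset.sum_div, Finset.sum_const, nsmul_eq_mul] at h2
    simp only [add_sub_cancel_right] at h1
    have h3 := div_le_div_of_nonneg_right h1 hd.le
    rw [neg_div, e] at h3
    linarith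
  · have h1 := (abs_le.1 (abs_sum_sawInt_sub_le hB0 hB hd)).2
    have h2 : ∑ i ∈ s, saw (x i) ≤ ∑ i ∈ s, (d + (sawInt (x i) - sawInt (x i - d)) / d) :=
      Finset.sum_le_sum fun i _ => saw_le hd hd1
    rw [Finset.sum_add_distrib, ← Finset.sum_div, Finset.sum_const, nsmul_eq_mul] at h2
    have h3 := div_le_div_of_nonneg_right h1 hd.le
    rw [e] at h3
    linarith

/-! ### The height of the circle and its differences -/

/-- The height of the circle of radius `R` above the abscissa `x`. -/
noncomputable def hgt (R x : ℝ) : ℝ := √(R ^ 2 - x ^ 2)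

theorem hgt_nonneg (R x : ℝ) : 0 ≤ hgt R x := Real.sqrt_nonneg _

theorem hgt_neg (R x : ℝ) : hgt R (-x) = hgt R x := by simp [hgt]

theorem hgt_le {R : ℝ} (hR : 0 ≤ R) (x : ℝ) : hgt R x ≤ R :=
  Real.sqrt_le_iff.2 ⟨hR, by nlinarith [sq_nonneg x]⟩

theorem hgt_sq {R x : ℝ} (h : x ^ 2 ≤ R ^ 2) : hgt R x ^ 2 = R ^ 2 - x ^ 2 :=
  Real.sq_sqrt (by linarith)

theorem le_hgt {R x : ℝ} (h : 2 * x ^ 2 ≤ R ^ 2) : 7 / 10 * R ≤ hgt R x :=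
  Real.le_sqrt_of_sq_le (by nlinarith [sq_nonneg R])

theorem add_sq_le_of_two_mul_sq_le {R x s : ℝ} (hR : 10 ≤ R) (h : 2 * x ^ 2 ≤ R ^ 2)
    (hs : |s| ≤ 1) : (x + s) ^ 2 ≤ R ^ 2 := by
  have hx : |x| ≤ 3 / 4 * R := abs_le_of_sq_le_sq (by nlinarith) (by linarith)
  have : |x + s| ≤ R := (abs_add_le _ _).trans (by linarith)
  exact sq_le_sq' (by linarith [(abs_le.1 this).1]) (abs_le.1 this).2

theorem abs_hgt_add_sub_le {R x s : ℝ} (hR : 10 ≤ R) (h : 2 * x ^ 2 ≤ R ^ 2) (hs : |s| ≤ 1) :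
    |hgt R (x + s) - hgt R x| ≤ 5 / 2 := by
  have hx : |x| ≤ 3 / 4 * R := abs_le_of_sq_le_sq (by nlinarith) (by linarith)
  have h1 := hgt_sq (add_sq_le_of_two_mul_sq_le hR h hs)
  have h2 := hgt_sq (x := x) (R := R) (by nlinarith [sq_nonneg x])
  have h3 := le_hgt h
  have h4 := hgt_nonneg R (x + s)
  have h5 : (hgt R (x + s) - hgt R x) * (hgt R (x + s) + hgt R x) = -(s * (2 * x + s)) := by
    linear_combination h1 - h2
  have h6 : |hgt R (x + s) - hgt R x| * (hgt R (x + s) + hgt R x) ≤ 2 * |x| + 1 := by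
    rw [← abs_of_nonneg (add_nonneg h4 (hgt_nonneg R x)), ← abs_mul, h5, abs_neg, abs_mul]
    have : |2 * x + s| ≤ 2 * |x| + 1 := by
      refine (abs_add_le _ _).trans ?_
      rw [abs_mul, abs_two]; linarith
    nlinarith [abs_nonneg s, abs_nonneg (2 * x + s)]
  by_contra! hc
  nlinarith

/-- An exact Taylor formula read off from `hgt² = R² - x²` at both points; no derivative of the
square root is needed. -/
theorem hgt_add_sub {R x s : ℝ} (hR : 10 ≤ R) (h : 2 * x ^ 2 ≤ R ^ 2) (hs : |s| ≤ 1) :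
    hgt R (x + s) - hgt R x =
      -(s * (x / hgt R x)) - (s ^ 2 + (hgt R (x + s) - hgt R x) ^ 2) / (2 * hgt R x) := by
  have h1 := hgt_sq (add_sq_le_of_two_mul_sq_le hR h hs)
  have h2 := hgt_sq (x := x) (R := R) (by nlinarith [sq_nonneg x])
  have h3 : 0 < hgt R x := by linarith [le_hgt h]
  field_simp
  linear_combination h1 - h2

theorem abs_hgt_taylor_le {R x s : ℝ} (hR : 10 ≤ R) (h : 2 * x ^ 2 ≤ R ^ 2) (hs : |s| ≤ 1) :
    |hgt R (x + s) - (hgt R x - s * (x / hgt R x))| ≤ 6 / R := by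
  have h1 := hgt_add_sub hR h hs
  have h2 := abs_le.1 (abs_hgt_add_sub_le hR h hs)
  have h3 := le_hgt h
  have h4 : 0 < hgt R x := by linarith
  have h5 : hgt R (x + s) - (hgt R x - s * (x / hgt R x)) =
      -((s ^ 2 + (hgt R (x + s) - hgt R x) ^ 2) / (2 * hgt R x)) := by linarith
  rw [h5, abs_neg, abs_of_nonneg (by positivity), div_le_div_iff₀ (by positivity) (by linarith)]
  have a1 : s ^ 2 ≤ 1 := by rw [← sq_abs]; nlinarith [abs_nonneg s]
  have a2 : (hgt R (x + s) - hgt R x) ^ 2 ≤ 25 / 4 := by nlinarith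
  nlinarith

theorem abs_div_hgt_le {R x : ℝ} (hR : 0 < R) (h : 2 * x ^ 2 ≤ R ^ 2) : |x / hgt R x| ≤ 1 := by
  have h3 : 0 < hgt R x := by linarith [le_hgt h]
  rw [abs_div, abs_of_pos h3, div_le_one h3]
  exact Real.le_sqrt_of_sq_le (by rw [sq_abs]; linarith)

/-- Adding the exact formulas for `s = 1` and `s = -1` cancels the linear terms and leaves `(2 + p²
+ q²) / (2H)`, where `p`, `q` are bounded and `H` lies between `7R/10` and `R`. -/
theorem hgt_second_difference {R x : ℝ} (hR : 10 ≤ R) (h : 2 * x ^ 2 ≤ R ^ 2) :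
    1 / R ≤ 2 * hgt R x - hgt R (x + 1) - hgt R (x - 1) ∧
      2 * hgt R x - hgt R (x + 1) - hgt R (x - 1) ≤ 11 / R := by
  have h1 := hgt_add_sub (s := 1) hR h (by simp)
  have h2 := hgt_add_sub (s := -1) hR h (by simp)
  have b1 := abs_le.1 (abs_hgt_add_sub_le (s := 1) hR h (by simp))
  have b2 := abs_le.1 (abs_hgt_add_sub_le (s := -1) hR h (by simp))
  rw [← sub_eq_add_neg] at h2 b2
  have h3 := le_hgt h
  have h4 := hgt_le (R := R) (by linarith) x
  set H := hgt R x
  set p := hgt R (x + 1) - H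
  set q := hgt R (x - 1) - H
  have e : 2 * H - hgt R (x + 1) - hgt R (x - 1) = (2 + p ^ 2 + q ^ 2) / (2 * H) := by
    have : 2 * H - hgt R (x + 1) - hgt R (x - 1) = -p - q := by simp only [p, q]; ring
    rw [this]
    linear_combination -h1 - h2
  rw [e]
  constructor
  · rw [div_le_div_iff₀ (by linarith) (by linarith)]; nlinarith [sq_nonneg p, sq_nonneg q]
  · have a1 : p ^ 2 ≤ 25 / 4 := by nlinarith
    have a2 : q ^ 2 ≤ 25 / 4 := by nlinarith
    rw [div_le_div_iff₀ (by linarith) (by linarith)]; nlinarith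

/-! ### Sawtooth sums along the circle -/

section ColumnSums

variable {R : ℝ} {M : ℕ}

theorem two_mul_natCast_sub_sq_le (hM : 2 * (M : ℝ) ^ 2 ≤ R ^ 2) {i : ℕ} (hi : i ≤ 2 * M) :
    2 * ((i : ℝ) - M) ^ 2 ≤ R ^ 2 := by
  have : ((i : ℝ) - M) ^ 2 ≤ (M : ℝ) ^ 2 := by
    have : (i : ℝ) ≤ 2 * M := by exact_mod_cast hi
    have : (0 : ℝ) ≤ i := by positivity
    apply sq_le_sq' <;> linarith
  linarith

theorem natCast_two_mul_add_one_le (hR : 10 ≤ R) (hM : 2 * (M : ℝ) ^ 2 ≤ R ^ 2) :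
    2 * (M : ℝ) + 1 ≤ 8 / 5 * R := by
  have : (M : ℝ) ≤ 3 / 4 * R := abs_le_of_sq_le_sq (by nlinarith) (by linarith) |>.trans' (le_abs_self _)
  have : (M : ℝ) ≤ 71 / 100 * R := by nlinarith
  linarith

/-- The height is concave, so the test is applied to the negated phase, with `lam = k / R` and `c =
11`. It requires `k ≤ R`; beyond that the number of terms is already below the bound. -/
theorem norm_sum_expi_hgt_le (hR : 10 ≤ R) (hM : 2 * (M : ℝ) ^ 2 ≤ R ^ 2) {n : ℕ}
    (hn : n ≤ 2 * M + 1) {k : ℕ} (hk : 1 ≤ k) :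
    ‖∑ i ∈ Finset.range n, expi (k * hgt R ((i : ℝ) - M))‖ ≤ 100 * √R * √k := by
  have hn' : (n : ℝ) ≤ 8 / 5 * R := by
    refine le_trans ?_ (natCast_two_mul_add_one_le hR hM)
    exact_mod_cast hn
  have hk' : (1 : ℝ) ≤ k := by exact_mod_cast hk
  have hsR : 0 < √R := Real.sqrt_pos.2 (by linarith)
  have hsk : 0 < √(k : ℝ) := Real.sqrt_pos.2 (by linarith)
  have hRR : √R * √R = R := Real.mul_self_sqrt (by linarith)
  have hkk : √(k : ℝ) * √(k : ℝ) = k := Real.mul_self_sqrt (by linarith)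
  rcases le_or_gt (k : ℝ) R with hkR | hkR
  · rw [← norm_sum_expi_neg]
    have h := norm_sum_expi_le_of_second_differences (N := n) (lam := k / R) (c := 11)
      (x := fun i => -(k * hgt R ((i : ℝ) - M))) (by positivity)
      ((div_le_one (by linarith)).2 hkR) (by norm_num) (by
        intro i hi
        have := (hgt_second_difference hR
          (two_mul_natCast_sub_sq_le hM (i := i + 1) (by omega))).1
        push_cast at this ⊢
        rw [show (i : ℝ) + 1 - M + 1 = i + 2 - M by ring,
          show (i : ℝ) + 1 - M - 1 = i - M by ring] at this
        have h2 := mul_le_mul_of_nonneg_left this (show (0 : ℝ) ≤ k by positivity)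
        rw [mul_one_div] at h2
        linarith) (by
        intro i hi
        have := (hgt_second_difference hR
          (two_mul_natCast_sub_sq_le hM (i := i + 1) (by omega))).2
        push_cast at this ⊢
        rw [show (i : ℝ) + 1 - M + 1 = i + 2 - M by ring,
          show (i : ℝ) + 1 - M - 1 = i - M by ring] at this
        have h2 := mul_le_mul_of_nonneg_left this (show (0 : ℝ) ≤ k by positivity)
        rw [show (k : ℝ) * (11 / R) = 11 * (k / R) by ring] at h2
        linarith)
    refine h.trans ?_
    rw [Real.sqrt_div (by linarith)]
    have t1 : 5 * 11 * (n : ℝ) * (√(k : ℝ) / √R) ≤ 88 * √R * √k := by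
      calc 5 * 11 * (n : ℝ) * (√(k : ℝ) / √R) ≤ 5 * 11 * (8 / 5 * R) * (√(k : ℝ) / √R) := by gcongr
        _ = _ := by
          nth_rewrite 1 [← hRR]
          field_simp
          norm_num
    have t2 : 10 / (√(k : ℝ) / √R) ≤ 10 * √R * √k := by
      rw [div_div_eq_mul_div, div_le_iff₀ hsk, mul_assoc, hkk]
      have : 0 ≤ 10 * √R := by positivity
      nlinarith
    have : 0 ≤ √R * √(k : ℝ) := by positivity
    linarith
  · refine (norm_sum_expi_le _ _).trans ?_
    rw [Finset.card_range]
    have : √R ≤ √(k : ℝ) := Real.sqrt_le_sqrt hkR.le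
    nlinarith

/-- The smoothing length `d = R^(-1/3)` balances `n * d` against `√R / √d`. Uniformity in `n` and in
the shift `c` is what the variance needs later, for partial summation and for counting in bins. -/
theorem abs_sum_saw_hgt_le (hR : 10 ≤ R) (hM : 2 * (M : ℝ) ^ 2 ≤ R ^ 2) {n : ℕ}
    (hn : n ≤ 2 * M + 1) (c : ℝ) :
    |∑ i ∈ Finset.range n, saw (hgt R ((i : ℝ) - M) - c)| ≤ 302 * R ^ (2 / 3 : ℝ) := by
  have hR0 : 0 < R := by linarith
  have hn' : (n : ℝ) ≤ 8 / 5 * R := by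
    refine le_trans ?_ (natCast_two_mul_add_one_le hR hM)
    exact_mod_cast hn
  have h := abs_sum_saw_le (s := Finset.range n) (x := fun i => hgt R ((i : ℝ) - M) - c)
    (B := 100 * √R) (d := R ^ (-(1 / 3) : ℝ)) (by positivity) (by
      intro k hk
      simp only [mul_sub]
      rw [norm_sum_expi_sub_const (x := fun i : ℕ => (k : ℝ) * hgt R ((i : ℝ) - M))]
      exact norm_sum_expi_hgt_le hR hM hn hk) (by positivity)
      (Real.rpow_le_one_of_one_le_of_nonpos (by linarith) (by norm_num))
  refine h.trans ?_
  rw [Finset.card_range]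
  have e1 : R * R ^ (-(1 / 3) : ℝ) = R ^ (2 / 3 : ℝ) := by
    nth_rewrite 1 [← Real.rpow_one R]
    rw [← Real.rpow_add hR0]; norm_num
  have e2 : 3 * (100 * √R) / √(R ^ (-(1 / 3) : ℝ)) = 300 * R ^ (2 / 3 : ℝ) := by
    rw [Real.sqrt_eq_rpow, Real.sqrt_eq_rpow, ← Real.rpow_mul hR0.le, ← mul_assoc, mul_div_assoc,
      ← Real.rpow_sub hR0]
    norm_num
  rw [e2]
  have : (n : ℝ) * R ^ (-(1 / 3) : ℝ) ≤ 8 / 5 * (R * R ^ (-(1 / 3) : ℝ)) := by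
    rw [← mul_assoc]; gcongr
  rw [e1] at this
  have : 0 ≤ R ^ (2 / 3 : ℝ) := by positivity
  linarith

end ColumnSums

/-! ### Areas of squares cut by the disc -/

/-- Truncation to the unit interval. -/
noncomputable def clamp (y : ℝ) : ℝ := max 0 (min y 1)

theorem clamp_nonneg (y : ℝ) : 0 ≤ clamp y := le_max_left _ _

theorem clamp_le_one (y : ℝ) : clamp y ≤ 1 := max_le zero_le_one (min_le_right _ _)

theorem abs_clamp_sub_le (x y : ℝ) : |clamp x - clamp y| ≤ |x - y| := by
  refine (abs_max_sub_max_le_max _ _ _ _).trans ?_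
  rw [sub_self, abs_zero]
  refine max_le (abs_nonneg _) ((abs_min_sub_min_le_max _ _ _ _).trans ?_)
  simp

theorem continuous_clamp : Continuous clamp := by unfold clamp; fun_prop

theorem continuous_hgt (R : ℝ) : Continuous (hgt R) := by unfold hgt; fun_prop

/-- The disc in `ℝ × ℝ`. -/
def discProd (R : ℝ) : Set (ℝ × ℝ) := {p | p.1 ^ 2 + p.2 ^ 2 < R ^ 2}

/-- The half-open unit square centred at a lattice point. -/
def tile (l : ℤ × ℤ) : Set (ℝ × ℝ) :=
  Set.Ico ((l.1 : ℝ) - 1 / 2) (l.1 + 1 / 2) ×ˢ Set.Ico ((l.2 : ℝ) - 1 / 2) (l.2 + 1 / 2)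

/-- The closed unit square centred at a lattice point. -/
def closedTile (l : ℤ × ℤ) : Set (ℝ × ℝ) :=
  Set.Icc ((l.1 : ℝ) - 1 / 2) (l.1 + 1 / 2) ×ˢ Set.Icc ((l.2 : ℝ) - 1 / 2) (l.2 + 1 / 2)

theorem measurableSet_discProd (R : ℝ) : MeasurableSet (discProd R) :=
  measurableSet_lt (by fun_prop) (by fun_prop)

theorem measurableSet_tile (l : ℤ × ℤ) : MeasurableSet (tile l) :=
  measurableSet_Ico.prod measurableSet_Ico

theorem measurableSet_closedTile (l : ℤ × ℤ) : MeasurableSet (closedTile l) :=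
  measurableSet_Icc.prod measurableSet_Icc

theorem measurePreserving_coords :
    MeasurePreserving (fun x : Plane => ((x 0, x 1) : ℝ × ℝ)) volume volume :=
  (volume_preserving_finTwoArrow ℝ).comp (PiLp.volume_preserving_ofLp (Fin 2))

theorem plane_norm_sq (x : Plane) : ‖x‖ ^ 2 = x 0 ^ 2 + x 1 ^ 2 := by
  rw [EuclideanSpace.norm_sq_eq, Fin.sum_univ_two]; simp

theorem norm_latticePoint_sq (l : ℤ × ℤ) :
    ‖latticePoint l‖ ^ 2 = (l.1 : ℝ) ^ 2 + (l.2 : ℝ) ^ 2 := by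
  rw [plane_norm_sq]; simp [latticePoint]

theorem disc_eq_preimage {R : ℝ} (hR : 0 < R) :
    disc R = (fun x : Plane => ((x 0, x 1) : ℝ × ℝ)) ⁻¹' discProd R := by
  ext x
  simp only [disc, discProd, Metric.mem_ball, dist_zero_right, Set.mem_preimage, Set.mem_ofPred_eq,
    ← plane_norm_sq]
  rw [sq_lt_sq₀ (norm_nonneg _) hR.le]

theorem squareAt_eq_preimage (l : ℤ × ℤ) :
    squareAt (latticePoint l) = (fun x : Plane => ((x 0, x 1) : ℝ × ℝ)) ⁻¹' closedTile l := by
  ext x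
  simp only [squareAt, unitSquare, closedTile, latticePoint, Set.mem_ofPred_eq, Fin.forall_fin_two,
    Set.mem_preimage, Set.mem_prod, Set.mem_Icc, PiLp.sub_apply]
  simp only [Matrix.cons_val_zero, Matrix.cons_val_one]
  constructor <;> rintro ⟨⟨a, b⟩, c, d⟩ <;> refine ⟨⟨?_, ?_⟩, ?_, ?_⟩ <;> linarith

theorem area_eq_closedTile {R : ℝ} (hR : 0 < R) (l : ℤ × ℤ) :
    area R l = volume.real (closedTile l ∩ discProd R) := by
  rw [area, squareAt_eq_preimage, disc_eq_preimage hR, ← Set.preimage_inter, measureReal_def,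
    measureReal_def, measurePreserving_coords.measure_preimage
      ((measurableSet_closedTile l).inter (measurableSet_discProd R)).nullMeasurableSet]

theorem tile_ae_eq (l : ℤ × ℤ) : tile l =ᵐ[volume] closedTile l :=
  Measure.set_prod_ae_eq Ico_ae_eq_Icc Ico_ae_eq_Icc

theorem area_eq_tile {R : ℝ} (hR : 0 < R) (l : ℤ × ℤ) :
    area R l = volume.real (tile l ∩ discProd R) := by
  rw [area_eq_closedTile hR, measureReal_def, measureReal_def]
  congr 1
  exact measure_congr ((tile_ae_eq l).symm.inter (ae_eq_refl _))

theorem volume_tile (l : ℤ × ℤ) : volume (tile l) = 1 := by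
  rw [tile, Measure.volume_eq_prod, Measure.prod_prod, Real.volume_Ico, Real.volume_Ico]
  norm_num

theorem area_nonneg (R : ℝ) (l : ℤ × ℤ) : 0 ≤ area R l := measureReal_nonneg

theorem volume_squareAt (l : ℤ × ℤ) : volume (squareAt (latticePoint l)) = 1 := by
  rw [squareAt_eq_preimage, measurePreserving_coords.measure_preimage
    (measurableSet_closedTile l).nullMeasurableSet, ← measure_congr (tile_ae_eq l), volume_tile]

theorem area_le_one (R : ℝ) (l : ℤ × ℤ) : area R l ≤ 1 := by
  have h := measureReal_mono (μ := volume) (Set.inter_subset_left (s := squareAt (latticePoint l))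
    (t := disc R)) (by rw [volume_squareAt]; simp)
  rwa [measureReal_def volume (squareAt _), volume_squareAt, ENNReal.toReal_one] at h

/-- The bound is half the diagonal of the square, which explains the width of the annulus. -/
theorem norm_sub_le_of_mem_squareAt {l : ℤ × ℤ} {x : Plane}
    (hx : x ∈ squareAt (latticePoint l)) : ‖x - latticePoint l‖ ≤ 1 / √2 := by
  have h : ∀ i, (x - latticePoint l) i ∈ Set.Icc (-(1 / 2) : ℝ) (1 / 2) := hx
  have h0 := h 0
  have h1 := h 1
  rw [Set.mem_Icc] at h0 h1
  have h2 := plane_norm_sq (x - latticePoint l)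
  refine le_of_sq_le_sq ?_ (by positivity)
  rw [h2, div_pow, Real.sq_sqrt (by norm_num)]
  nlinarith

theorem area_eq_zero {R : ℝ} {l : ℤ × ℤ} (h : R + 1 / √2 ≤ ‖latticePoint l‖) : area R l = 0 := by
  have : squareAt (latticePoint l) ∩ disc R = ∅ := by
    rw [Set.eq_empty_iff_forall_notMem]
    rintro x ⟨hx, hx2⟩
    rw [disc, Metric.mem_ball, dist_zero_right] at hx2
    have h1 := norm_sub_le_of_mem_squareAt hx
    have h2 := norm_sub_norm_le (latticePoint l) x
    rw [norm_sub_rev] at h2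
    linarith
  rw [area, this, measureReal_empty]

theorem area_eq_one {R : ℝ} {l : ℤ × ℤ} (h : ‖latticePoint l‖ ≤ R - 1 / √2) :
    area R l = 1 := by
  have hsub : squareAt (latticePoint l) ⊆ Metric.closedBall (0 : Plane) R := by
    intro x hx
    rw [Metric.mem_closedBall, dist_zero_right]
    have h1 := norm_sub_le_of_mem_squareAt hx
    have h2 := norm_sub_norm_le x (latticePoint l)
    linarith
  -- When the centre is at distance exactly `R - 1/√2` a corner may lie on the circle, outside the
  -- open disc; the circle is a null set.
  have hae : disc R =ᵐ[volume] Metric.closedBall (0 : Plane) R := by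
    rw [disc, ← Metric.ball_union_sphere]
    have : volume (Metric.sphere (0 : Plane) R) = 0 := Measure.addHaar_sphere _ _ _
    exact (union_ae_eq_left_of_ae_eq_empty (ae_eq_empty.2 this)).symm
  rw [area, measureReal_def, measure_congr ((ae_eq_refl _).inter hae),
    Set.inter_eq_left.2 hsub, volume_squareAt, ENNReal.toReal_one]

theorem area_rotate {R : ℝ} (hR : 0 < R) (m n : ℤ) : area R (-n, m) = area R (m, n) := by
  have hf : MeasurePreserving (fun p : ℝ × ℝ => ((-p.2, p.1) : ℝ × ℝ)) volume volume :=
    ((Measure.measurePreserving_neg (volume : Measure ℝ)).prod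
      (MeasurePreserving.id (volume : Measure ℝ))).comp Measure.measurePreserving_swap
  rw [area_eq_closedTile hR, area_eq_closedTile hR, measureReal_def, measureReal_def,
    ← hf.measure_preimage ((measurableSet_closedTile _).inter
      (measurableSet_discProd R)).nullMeasurableSet]
  congr 2
  ext ⟨x, y⟩
  simp only [closedTile, discProd, Set.mem_preimage, Set.mem_inter_iff, Set.mem_prod, Set.mem_Icc,
    Set.mem_ofPred_eq, Int.cast_neg, neg_sq]
  constructor <;> rintro ⟨⟨⟨a, b⟩, c, d⟩, e⟩ <;> refine ⟨⟨⟨?_, ?_⟩, ?_, ?_⟩, ?_⟩ <;> linarith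

theorem volume_discProd {R : ℝ} (hR : 0 < R) : volume.real (discProd R) = Real.pi * R ^ 2 := by
  rw [measureReal_def, ← measurePreserving_coords.measure_preimage
    (measurableSet_discProd R).nullMeasurableSet, ← disc_eq_preimage hR, disc,
    EuclideanSpace.volume_ball_fin_two, ENNReal.toReal_mul, ENNReal.toReal_pow,
    ENNReal.toReal_ofReal hR.le]
  simp [mul_comm, Real.pi_pos.le]

/-- The lattice points in a centred square box. -/
noncomputable def box (B : ℤ) : Finset (ℤ × ℤ) := Finset.Icc (-B) B ×ˢ Finset.Icc (-B) B

theorem mem_box {B m n : ℤ} : (m, n) ∈ box B ↔ (-B ≤ m ∧ m ≤ B) ∧ -B ≤ n ∧ n ≤ B := by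
  simp [box]

theorem mem_tile_iff {l : ℤ × ℤ} {p : ℝ × ℝ} :
    p ∈ tile l ↔ ⌊p.1 + 1 / 2⌋ = l.1 ∧ ⌊p.2 + 1 / 2⌋ = l.2 := by
  simp only [tile, Set.mem_prod, Set.mem_Ico, Int.floor_eq_iff]
  constructor <;> rintro ⟨⟨a, b⟩, c, d⟩ <;> refine ⟨⟨?_, ?_⟩, ?_, ?_⟩ <;> linarith

/-- Half-open tiles are disjoint and cover the plane, and the box contains the centre of every tile
that meets the disc. -/
theorem sum_area_box {R : ℝ} (hR : 0 < R) {B : ℤ} (hB : R + 1 ≤ B) :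
    ∑ l ∈ box B, area R l = Real.pi * R ^ 2 := by
  have hd : (discProd R) = ⋃ l ∈ box B, tile l ∩ discProd R := by
    ext p
    simp only [Set.mem_iUnion, Set.mem_inter_iff, exists_prop]
    constructor
    · intro hp
      refine ⟨(⌊p.1 + 1 / 2⌋, ⌊p.2 + 1 / 2⌋), ?_, mem_tile_iff.2 ⟨rfl, rfl⟩, hp⟩
      have hp' : p.1 ^ 2 + p.2 ^ 2 < R ^ 2 := hp
      have h1 := abs_lt_of_sq_lt_sq (show p.1 ^ 2 < R ^ 2 by nlinarith [sq_nonneg p.2]) hR.le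
      have h2 := abs_lt_of_sq_lt_sq (show p.2 ^ 2 < R ^ 2 by nlinarith [sq_nonneg p.1]) hR.le
      rw [abs_lt] at h1 h2
      rw [mem_box]
      refine ⟨⟨?_, ?_⟩, ?_, ?_⟩
      · rw [Int.le_floor]; push_cast; linarith
      · rw [← Int.lt_add_one_iff, Int.floor_lt]; push_cast; linarith
      · rw [Int.le_floor]; push_cast; linarith
      · rw [← Int.lt_add_one_iff, Int.floor_lt]; push_cast; linarith
    · rintro ⟨_, _, _, h⟩; exact h
  have hfin : ∀ l ∈ box B, volume (tile l ∩ discProd R) ≠ ⊤ := fun l _ =>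
    ((measure_mono Set.inter_subset_left).trans_lt (by rw [volume_tile]; simp)).ne
  rw [← volume_discProd hR, hd, measureReal_biUnion_finset _ _ hfin]
  · exact Finset.sum_congr rfl fun l _ => area_eq_tile hR l
  · rintro ⟨a, b⟩ _ ⟨c, d⟩ _ hne
    rw [Function.onFun, Set.disjoint_left]
    rintro p ⟨h1, _⟩ ⟨h2, _⟩
    rw [mem_tile_iff] at h1 h2
    exact hne (Prod.ext (h1.1.symm.trans h2.1) (h1.2.symm.trans h2.2))
  · exact fun l _ => (measurableSet_tile l).inter (measurableSet_discProd R)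

/-- Fubini over vertical slices. As `n ≥ 1`, the tile lies in the upper half plane and only the
upper arc can cut it. -/
theorem area_eq_integral {R : ℝ} (hR : 0 < R) (m : ℤ) {n : ℤ} (hn : 1 ≤ n) :
    area R (m, n) = ∫ s in (-(1 / 2) : ℝ)..(1 / 2), clamp (hgt R (m + s) - n + 1 / 2) := by
  have hn' : (1 : ℝ) ≤ n := by exact_mod_cast hn
  have hslice : ∀ x : ℝ, volume (Prod.mk x ⁻¹' (tile (m, n) ∩ discProd R)) =
      (Set.Ico ((m : ℝ) - 1 / 2) (m + 1 / 2)).indicator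
        (fun x => ENNReal.ofReal (clamp (hgt R x - n + 1 / 2))) x := by
    intro x
    by_cases hx : x ∈ Set.Ico ((m : ℝ) - 1 / 2) (m + 1 / 2)
    · rw [Set.indicator_of_mem hx]
      have : Prod.mk x ⁻¹' (tile (m, n) ∩ discProd R) =
          Set.Ico ((n : ℝ) - 1 / 2) (min (n + 1 / 2) (hgt R x)) := by
        ext y
        simp only [tile, discProd, Set.mem_preimage, Set.mem_inter_iff, Set.mem_prod, hx, true_and,
          Set.mem_ofPred_eq, Set.mem_Ico, lt_min_iff, and_assoc]
        refine and_congr_right fun h1 => and_congr_right fun _ => ?_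
        rw [hgt, Real.lt_sqrt (by linarith)]
        constructor <;> intro h <;> linarith
      rw [this, Real.volume_Ico, clamp, ENNReal.ofReal_max, ENNReal.ofReal_zero]
      rw [max_eq_right (zero_le)]
      congr 1
      rw [min_comm, ← min_sub_sub_right]
      congr 1 <;> ring
    · rw [Set.indicator_of_notMem hx]
      convert! measure_empty (μ := (volume : Measure ℝ))
      rw [Set.eq_empty_iff_forall_notMem]
      rintro y ⟨h, _⟩
      exact hx h.1
  have hcont : Continuous fun x => clamp (hgt R x - n + 1 / 2) :=
    continuous_clamp.comp (by have := continuous_hgt R; fun_prop)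
  rw [area_eq_tile hR, measureReal_def, Measure.volume_eq_prod,
    Measure.prod_apply ((measurableSet_tile _).inter (measurableSet_discProd R))]
  simp_rw [hslice]
  rw [lintegral_indicator measurableSet_Ico, ← ofReal_integral_eq_lintegral_ofReal,
    ENNReal.toReal_ofReal, integral_Ico_eq_integral_Ioc,
    ← intervalIntegral.integral_of_le (by linarith)]
  · rw [intervalIntegral.integral_comp_add_left (fun x => clamp (hgt R x - n + 1 / 2)) (m : ℝ),
      ← sub_eq_add_neg]
  · exact integral_nonneg fun x => clamp_nonneg _
  · exact (hcont.integrableOn_Icc (a := (m : ℝ) - 1 / 2) (b := m + 1 / 2)).mono_set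
      Set.Ico_subset_Icc_self
  · exact Filter.Eventually.of_forall fun x => clamp_nonneg _

/-! ### Reduction by symmetry to short columns -/

theorem abs_sum_le_card_of_eq_zero {ι : Type*} {S E : Finset ι} {f : ι → ℝ}
    (h0 : ∀ i ∈ S, i ∉ E → f i = 0) (h1 : ∀ i, |f i| ≤ 1) : |∑ i ∈ S, f i| ≤ E.card := by
  classical
  have : ∑ i ∈ S ∩ E, f i = ∑ i ∈ S, f i :=
    Finset.sum_subset Finset.inter_subset_left fun i hi hn =>
      h0 i hi fun hE => hn (Finset.mem_inter.2 ⟨hi, hE⟩)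
  rw [← this]
  refine (Finset.abs_sum_le_sum_abs _ _).trans ?_
  refine (Finset.sum_le_sum fun i _ => h1 i).trans ?_
  rw [Finset.sum_const, nsmul_eq_mul, mul_one]
  exact_mod_cast Finset.card_le_card Finset.inter_subset_right

theorem sum_Icc_int_eq_sum_range (f : ℤ → ℝ) (a : ℤ) (k : ℕ) :
    ∑ n ∈ Finset.Icc a (a + k), f n = ∑ j ∈ Finset.range (k + 1), f (a + j) := by
  refine Finset.sum_nbij' (fun n => (n - a).toNat) (fun j => a + j) ?_ ?_ ?_ ?_ ?_
  · intro n hn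
    rw [Finset.mem_Icc] at hn
    rw [Finset.mem_range]; omega
  · intro j hj
    rw [Finset.mem_range] at hj
    rw [Finset.mem_Icc]; omega
  · intro n hn
    rw [Finset.mem_Icc] at hn
    omega
  · intro j hj
    omega
  · intro n hn
    rw [Finset.mem_Icc] at hn
    congr 1; omega

/-- The sum of `T` over the seven lattice points nearest to the circle in a column. -/
noncomputable def columnSum (R : ℝ) (T : ℤ × ℤ → ℝ) (m : ℤ) : ℝ :=
  ∑ j ∈ Finset.range 7, T (m, ⌊hgt R m⌋ - 3 + j)

theorem sum_box_rotate (f : ℤ × ℤ → ℝ) (B : ℤ) :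
    ∑ l ∈ box B, f (-l.2, l.1) = ∑ l ∈ box B, f l := by
  refine Finset.sum_nbij' (fun l => (-l.2, l.1)) (fun l => (l.2, -l.1)) ?_ ?_ ?_ ?_ ?_
  · rintro ⟨m, n⟩ h
    rw [mem_box] at h ⊢; omega
  · rintro ⟨m, n⟩ h
    rw [mem_box] at h ⊢; omega
  · rintro ⟨m, n⟩ _; simp
  · rintro ⟨m, n⟩ _; simp
  · rintro ⟨m, n⟩ _; rfl

/-- The restriction of `T` to the cone `-n < m ≤ n`. -/
def coneRestrict (T : ℤ × ℤ → ℝ) (l : ℤ × ℤ) : ℝ := if -l.2 < l.1 ∧ l.1 ≤ l.2 then T l else 0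

/-- The quarter turns of the half-open cone partition the lattice points other than the origin, each
diagonal ray being counted once. -/
theorem sum_box_eq_cone {T : ℤ × ℤ → ℝ} (hrot : ∀ m n, T (-n, m) = T (m, n)) (h0 : T (0, 0) = 0)
    (B : ℤ) : ∑ l ∈ box B, T l = 4 * ∑ l ∈ box B, coneRestrict T l := by
  have h3 : ∀ m n, T (n, -m) = T (m, n) := fun m n => by
    have := hrot (n) (-m); rw [neg_neg] at this; exact this.symm
  set C := coneRestrict T with hC
  have e : ∀ l : ℤ × ℤ, T l = C l + C (-l.2, l.1) + C (-l.1, -l.2) + C (l.2, -l.1) := by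
    rintro ⟨m, n⟩
    simp only [hC, coneRestrict, hrot, h3]
    by_cases hz : m = 0 ∧ n = 0
    · obtain ⟨rfl, rfl⟩ := hz
      simp [h0]
    · split_ifs <;> first | (exfalso; omega) | ring
  have s1 := sum_box_rotate C B
  have s2 := sum_box_rotate (fun l => C (-l.2, l.1)) B
  have s3 := sum_box_rotate (fun l => C (-l.1, -l.2)) B
  simp only [neg_neg] at s2 s3
  rw [Finset.sum_congr rfl fun l _ => e l, Finset.sum_add_distrib, Finset.sum_add_distrib,
    Finset.sum_add_distrib, s3, s2, s1]
  ring

section Reduction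

variable {R : ℝ} {M : ℕ} {B : ℤ} {T : ℤ × ℤ → ℝ}

theorem le_hgt_of_abs_le (hM : 2 * ((M : ℝ) + 10) ^ 2 ≤ R ^ 2) {m : ℤ} (hm : |m| ≤ M) :
    (M : ℝ) + 10 ≤ hgt R m := by
  have : ((m : ℝ)) ^ 2 ≤ (M : ℝ) ^ 2 := by
    rw [← sq_abs]
    have : |(m : ℝ)| ≤ M := by exact_mod_cast hm
    gcongr
  exact Real.le_sqrt_of_sq_le (by nlinarith [(Nat.cast_nonneg M : (0 : ℝ) ≤ M)])

theorem two_mul_intCast_sq_le (hM : 2 * ((M : ℝ) + 10) ^ 2 ≤ R ^ 2) {m : ℤ} (hm : |m| ≤ M) :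
    2 * (m : ℝ) ^ 2 ≤ R ^ 2 := by
  have : ((m : ℝ)) ^ 2 ≤ (M : ℝ) ^ 2 := by
    rw [← sq_abs]
    have : |(m : ℝ)| ≤ M := by exact_mod_cast hm
    gcongr
  nlinarith [(Nat.cast_nonneg M : (0 : ℝ) ≤ M)]

/-- Where the slope of the circle is at most one, an annulus point of the column is within three of
`⌊hgt R m⌋`. The margin of ten in `hM` keeps that window inside the cone, so the cone condition can
be dropped there. -/
theorem sum_cone_column (hR : 100 ≤ R) (hM : 2 * ((M : ℝ) + 10) ^ 2 ≤ R ^ 2) (hB : R + 4 ≤ B)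
    (hT : ∀ m n : ℤ, T (m, n) ≠ 0 → (R - 1) ^ 2 < (m : ℝ) ^ 2 + (n : ℝ) ^ 2 ∧
      (m : ℝ) ^ 2 + (n : ℝ) ^ 2 < (R + 1) ^ 2) {m : ℤ} (hm : |m| ≤ M) :
    ∑ n ∈ Finset.Icc (-B) B, coneRestrict T (m, n) = columnSum R T m := by
  have h1 := le_hgt_of_abs_le hM hm
  have h2 := two_mul_intCast_sq_le hM hm
  have h3 := le_hgt h2
  have h4 := hgt_sq (R := R) (x := m) (by nlinarith [sq_nonneg (m : ℝ)])
  have h5 := hgt_le (R := R) (by linarith) m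
  rw [columnSum, ← sum_Icc_int_eq_sum_range (fun n => T (m, n)) (⌊hgt R m⌋ - 3) 6]
  set h := hgt R m
  have f1 := Int.floor_le h
  have f2 := Int.lt_floor_add_one h
  set k := ⌊h⌋
  have hMk : (M : ℤ) + 10 ≤ k := by rw [Int.le_floor]; push_cast; linarith
  have hkB : k + 4 ≤ B := by
    have : (k : ℝ) + 4 ≤ B := by linarith
    exact_mod_cast this
  rw [abs_le] at hm
  symm
  have : ∑ n ∈ Finset.Icc (k - 3) (k - 3 + (6 : ℕ)), T (m, n) =
      ∑ n ∈ Finset.Icc (k - 3) (k - 3 + (6 : ℕ)), coneRestrict T (m, n) := by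
    refine Finset.sum_congr rfl fun n hn => ?_
    rw [Finset.mem_Icc] at hn
    rw [coneRestrict, if_pos]
    constructor <;> simp only <;> omega
  rw [this]
  apply Finset.sum_subset
  · intro n hn
    rw [Finset.mem_Icc] at hn ⊢
    omega
  · intro n _ hn
    rw [Finset.mem_Icc, not_and_or, not_le, not_le] at hn
    rw [coneRestrict]
    split_ifs with hc
    · by_contra hne
      obtain ⟨t1, t2⟩ := hT m n hne
      simp only at hc
      have hn0 : (0 : ℝ) ≤ n := by
        have : 0 ≤ n := by omega
        exact_mod_cast this
      rcases hn with hn | hn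
      · have hn' : n + 4 ≤ k := by omega
        have hn'' : (n : ℝ) + 4 ≤ k := by exact_mod_cast hn'
        have : (n : ℝ) ^ 2 ≤ (h - 4) ^ 2 := by
          apply pow_le_pow_left₀ hn0; linarith
        nlinarith
      · have hn' : k + 4 ≤ n := by push_cast at hn; omega
        have hn'' : (k : ℝ) + 4 ≤ n := by exact_mod_cast hn'
        have : (h + 3) ^ 2 ≤ (n : ℝ) ^ 2 := by
          apply pow_le_pow_left₀ <;> linarith
        nlinarith
    · rfl

theorem abs_sum_box_sub_columns_le (hR : 100 ≤ R) (hM : 2 * ((M : ℝ) + 10) ^ 2 ≤ R ^ 2)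
    (hM' : R ^ 2 < 2 * ((M : ℝ) + 11) ^ 2) (hB : R + 4 ≤ B)
    (hrot : ∀ m n, T (-n, m) = T (m, n)) (hT1 : ∀ l, |T l| ≤ 1)
    (hT : ∀ m n : ℤ, T (m, n) ≠ 0 → (R - 1) ^ 2 < (m : ℝ) ^ 2 + (n : ℝ) ^ 2 ∧
      (m : ℝ) ^ 2 + (n : ℝ) ^ 2 < (R + 1) ^ 2) :
    |∑ l ∈ box B, T l - 4 * ∑ i ∈ Finset.range (2 * M + 1), columnSum R T (i - M)| ≤ 3000 := by
  have hT0 : T (0, 0) = 0 := by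
    by_contra h
    have := (hT 0 0 h).1
    norm_num at this
    nlinarith
  have hM0 : (0 : ℝ) ≤ M := Nat.cast_nonneg M
  have hMR : (M : ℝ) + 10 ≤ R := by
    by_contra! h
    nlinarith
  have hMB : (M : ℤ) ≤ B := by
    have : (M : ℝ) ≤ B := by linarith
    exact_mod_cast this
  have hRM : 2 * R ≤ 3 * (M + 11) := by
    by_contra! h
    nlinarith
  rw [sum_box_eq_cone hrot hT0, ← mul_sub, abs_mul, box, Finset.sum_product]
  have hsub : Finset.Icc (-(M : ℤ)) M ⊆ Finset.Icc (-B) B := by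
    intro m hm
    rw [Finset.mem_Icc] at hm ⊢
    omega
  rw [← Finset.sum_sdiff hsub]
  have hmain : ∑ m ∈ Finset.Icc (-(M : ℤ)) M, ∑ n ∈ Finset.Icc (-B) B, coneRestrict T (m, n) =
      ∑ i ∈ Finset.range (2 * M + 1), columnSum R T (i - M) := by
    rw [Finset.sum_congr rfl fun m hm => sum_cone_column hR hM hB hT
      (abs_le.2 (Finset.mem_Icc.1 hm))]
    have := sum_Icc_int_eq_sum_range (columnSum R T) (-M) (2 * M)
    rw [show -(M : ℤ) + ((2 * M : ℕ) : ℤ) = M by push_cast; ring] at this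
    rw [this]
    exact Finset.sum_congr rfl fun i _ => by rw [neg_add_eq_sub]
  rw [hmain, add_sub_cancel_right, ← Finset.sum_product (f := coneRestrict T)]
  -- The remaining cone points of the annulus cluster where the circle meets the diagonals: at most
  -- `24 * 26 = 624` of them, hence an error of at most `4 * 624`.
  set E : Finset (ℤ × ℤ) := (Finset.Icc ((M : ℤ) + 1) (M + 12) ∪
    Finset.Icc (-(M : ℤ) - 12) (-M - 1)) ×ˢ Finset.Icc ((M : ℤ) + 1) (M + 26) with hE
  have hcard : E.card ≤ 624 := by
    rw [hE, Finset.card_product]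
    have := Finset.card_union_le (Finset.Icc ((M : ℤ) + 1) (M + 12))
      (Finset.Icc (-(M : ℤ) - 12) (-M - 1))
    simp only [Int.card_Icc] at this ⊢
    have e1 : ((M : ℤ) + 12 + 1 - (M + 1)).toNat = 12 := by omega
    have e2 : (-(M : ℤ) - 1 + 1 - (-M - 12)).toNat = 12 := by omega
    have e3 : ((M : ℤ) + 26 + 1 - (M + 1)).toNat = 26 := by omega
    rw [e1, e2] at this
    rw [e3]
    omega
  have := abs_sum_le_card_of_eq_zero (S := (Finset.Icc (-B) B \ Finset.Icc (-(M : ℤ)) M) ×ˢ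
    Finset.Icc (-B) B) (E := E) (f := coneRestrict T) (by
      rintro ⟨m, n⟩ hS hnE
      rw [Finset.mem_product, Finset.mem_sdiff] at hS
      have hm := hS.1.2
      rw [Finset.mem_Icc] at hm
      rw [coneRestrict]
      split_ifs with hc
      · by_contra hne
        obtain ⟨t1, t2⟩ := hT m n hne
        simp only at hc
        apply hnE
        have hnm : |m| ≤ n := abs_le.2 ⟨by omega, hc.2⟩
        have hmM : (M : ℤ) + 1 ≤ |m| := by rw [le_abs]; omega
        have hnm' : |(m : ℝ)| ≤ n := by exact_mod_cast hnm
        have hmM' : (M : ℝ) + 1 ≤ |(m : ℝ)| := by exact_mod_cast hmM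
        rw [← sq_abs (m : ℝ)] at t2
        have hm12 : |m| ≤ M + 12 := by
          by_contra! h
          have h' : (M : ℤ) + 13 ≤ |m| := by omega
          have h'' : (M : ℝ) + 13 ≤ |(m : ℝ)| := by exact_mod_cast h'
          nlinarith
        have hn26 : n ≤ M + 26 := by
          by_contra! h
          have h' : (M : ℤ) + 27 ≤ n := by omega
          have h'' : (M : ℝ) + 27 ≤ n := by exact_mod_cast h'
          nlinarith
        rw [hE, Finset.mem_product, Finset.mem_union, Finset.mem_Icc, Finset.mem_Icc,
          Finset.mem_Icc]
        simp only
        rw [abs_le] at hm12 hnm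
        rw [le_abs] at hmM
        omega
      · rfl) (by
      intro l
      rw [coneRestrict]
      split_ifs
      · exact hT1 l
      · simp)
  have h4 : (E.card : ℝ) ≤ 624 := by exact_mod_cast hcard
  rw [abs_of_pos (by norm_num : (0 : ℝ) < 4)]
  linarith

end Reduction

theorem exists_column_bound {R : ℝ} (hR : 100 ≤ R) :
    ∃ M : ℕ, 2 * ((M : ℝ) + 10) ^ 2 ≤ R ^ 2 ∧ R ^ 2 < 2 * ((M : ℝ) + 11) ^ 2 := by
  have h2 : √2 ^ 2 = (2 : ℝ) := Real.sq_sqrt (by norm_num)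
  have h0 : 0 < √(2 : ℝ) := by positivity
  have h3 : √(2 : ℝ) < 3 / 2 := by nlinarith
  have h1 : 10 ≤ R / √2 := by rw [le_div_iff₀ h0]; nlinarith
  refine ⟨⌊R / √2 - 10⌋₊, ?_, ?_⟩
  · have := Nat.floor_le (show 0 ≤ R / √2 - 10 by linarith)
    have h : ((⌊R / √2 - 10⌋₊ : ℝ) + 10) ^ 2 ≤ (R / √2) ^ 2 := by
      gcongr; linarith
    rw [div_pow, h2] at h
    linarith
  · have := Nat.lt_floor_add_one (R / √2 - 10)
    have h : (R / √2) ^ 2 < ((⌊R / √2 - 10⌋₊ : ℝ) + 11) ^ 2 := by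
      gcongr; linarith
    rw [div_pow, h2] at h
    linarith

/-! ### The circle problem with exponent `2/3` -/

theorem clamp_eq_sub (y : ℝ) : clamp y = max 0 y - max 0 (y - 1) := by
  rw [clamp]
  rcases le_total y 0 with h | h
  · rw [min_eq_left (h.trans zero_le_one), max_eq_left h, max_eq_left (by linarith), sub_zero]
  · rcases le_total y 1 with h1 | h1
    · rw [min_eq_left h1, max_eq_right h, max_eq_left (by linarith)]; ring
    · rw [min_eq_right h1, max_eq_right h, max_eq_right (by linarith), max_eq_right (by linarith)]
      ring

/-- A truncation is a difference of positive parts at consecutive arguments, so the sum over a stack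
of unit cells telescopes. -/
theorem sum_clamp_sub (a : ℝ) (k : ℕ) (h0 : 0 ≤ a) (h1 : a ≤ k) :
    ∑ j ∈ Finset.range k, clamp (a - j) = a := by
  have : ∀ j ∈ Finset.range k, clamp (a - j) =
      (fun i : ℕ => max 0 (a - i)) j - (fun i : ℕ => max 0 (a - i)) (j + 1) := by
    intro j _
    rw [clamp_eq_sub]
    push_cast
    ring_nf
  rw [Finset.sum_congr rfl this, Finset.sum_range_sub']
  simp only [Nat.cast_zero, sub_zero]
  rw [max_eq_right h0, max_eq_left (by linarith), sub_zero]

theorem norm_latticePoint_le_iff {R : ℝ} (hR : 0 ≤ R) (m n : ℤ) :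
    ‖latticePoint (m, n)‖ ≤ R ↔ (m : ℝ) ^ 2 + (n : ℝ) ^ 2 ≤ R ^ 2 := by
  rw [← sq_le_sq₀ (norm_nonneg _) hR, norm_latticePoint_sq]

theorem norm_latticePoint_rotate (m n : ℤ) :
    ‖latticePoint (-n, m)‖ = ‖latticePoint (m, n)‖ := by
  rw [← sq_eq_sq₀ (norm_nonneg _) (norm_nonneg _), norm_latticePoint_sq, norm_latticePoint_sq]
  push_cast; ring

theorem one_div_sqrt_two_lt_one : 1 / √(2 : ℝ) < 1 := by
  rw [div_lt_one (by positivity), Real.lt_sqrt (by norm_num)]; norm_num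

theorem one_div_sqrt_two_pos : 0 < 1 / √(2 : ℝ) := by positivity

theorem sq_bounds_of_mem_annulus {R : ℝ} (hR : 1 ≤ R) {m n : ℤ}
    (h : latticePoint (m, n) ∈ annulus R) :
    (R - 1) ^ 2 < (m : ℝ) ^ 2 + (n : ℝ) ^ 2 ∧ (m : ℝ) ^ 2 + (n : ℝ) ^ 2 < (R + 1) ^ 2 := by
  have h2 := norm_latticePoint_sq (m, n)
  simp only at h2
  rw [← h2]
  have := one_div_sqrt_two_lt_one
  obtain ⟨h3, h4⟩ := h
  constructor
  · exact pow_lt_pow_left₀ (by linarith) (by linarith) two_ne_zero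
  · exact pow_lt_pow_left₀ (by linarith) (norm_nonneg _) two_ne_zero

/-- The indicator of the disc minus the covered area, at a lattice point. -/
noncomputable def countDefect (R : ℝ) (l : ℤ × ℤ) : ℝ :=
  (if ‖latticePoint l‖ ≤ R then 1 else 0) - area R l

theorem abs_countDefect_le (R : ℝ) (l : ℤ × ℤ) : |countDefect R l| ≤ 1 := by
  have h0 := area_nonneg R l
  have h1 := area_le_one R l
  rw [countDefect, abs_le]
  split_ifs <;> constructor <;> linarith

theorem countDefect_rotate {R : ℝ} (hR : 0 < R) (m n : ℤ) :
    countDefect R (-n, m) = countDefect R (m, n) := by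
  rw [countDefect, countDefect, area_rotate hR, norm_latticePoint_rotate]

theorem mem_annulus_of_countDefect_ne_zero {R : ℝ} {l : ℤ × ℤ}
    (h : countDefect R l ≠ 0) : latticePoint l ∈ annulus R := by
  have h0 := one_div_sqrt_two_pos
  by_contra hn
  apply h
  rw [annulus, Set.mem_ofPred_eq, not_and_or, not_lt, not_lt] at hn
  rw [countDefect]
  rcases hn with hn | hn
  · rw [area_eq_one hn, if_pos (by linarith), sub_self]
  · rw [area_eq_zero hn, if_neg (by linarith), sub_self]

/-- The tangent at the centre of the column integrates exactly to the central height; only the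
Taylor remainder is left. -/
theorem integral_hgt_sub_le {R x : ℝ} (hR : 10 ≤ R) (h : 2 * x ^ 2 ≤ R ^ 2) :
    |(∫ s in (-(1 / 2) : ℝ)..(1 / 2), hgt R (x + s)) - hgt R x| ≤ 6 / R := by
  have e : ∫ s in (-(1 / 2) : ℝ)..(1 / 2), (hgt R x - s * (x / hgt R x)) = hgt R x := by
    rw [intervalIntegral.integral_sub (by simp) (by apply Continuous.intervalIntegrable; fun_prop)]
    rw [intervalIntegral.integral_mul_const, integral_id]
    simp
    norm_num
  have hc := continuous_hgt R
  rw [show (∫ s in (-(1 / 2) : ℝ)..(1 / 2), hgt R (x + s)) - hgt R x =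
    (∫ s in (-(1 / 2) : ℝ)..(1 / 2), hgt R (x + s)) -
      ∫ s in (-(1 / 2) : ℝ)..(1 / 2), (hgt R x - s * (x / hgt R x)) by rw [e], ← intervalIntegral.integral_sub (by apply Continuous.intervalIntegrable; fun_prop)
    (by apply Continuous.intervalIntegrable; fun_prop)]
  have := intervalIntegral.norm_integral_le_of_norm_le_const (a := (-(1 / 2) : ℝ)) (b := 1 / 2)
    (C := 6 / R) (f := fun s => hgt R (x + s) - (hgt R x - s * (x / hgt R x))) (by
      intro s hs
      rw [Set.uIoc_of_le (by norm_num)] at hs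
      exact abs_hgt_taylor_le hR h (abs_le.2 ⟨by linarith [hs.1], by linarith [hs.2]⟩))
  rw [Real.norm_eq_abs] at this
  refine this.trans (le_of_eq ?_)
  norm_num

section Columns

variable {R : ℝ} {M : ℕ}

theorem four_le_floor_hgt (hM : 2 * ((M : ℝ) + 10) ^ 2 ≤ R ^ 2) {m : ℤ} (hm : |m| ≤ M) :
    4 ≤ ⌊hgt R m⌋ := by
  rw [Int.le_floor]
  have := le_hgt_of_abs_le hM hm
  have : (0 : ℝ) ≤ M := Nat.cast_nonneg M
  push_cast; linarith

/-- The seven tiles stack to a strip from `⌊hgt R m⌋ - 7/2` to `⌊hgt R m⌋ + 7/2`. The arc moves by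
at most `5/2` over the column and does not leave the strip, so the area under it is exact. -/
theorem columnSum_area (hR : 100 ≤ R) (hM : 2 * ((M : ℝ) + 10) ^ 2 ≤ R ^ 2) {m : ℤ}
    (hm : |m| ≤ M) :
    columnSum R (area R) m =
      (∫ s in (-(1 / 2) : ℝ)..(1 / 2), hgt R (m + s)) - ⌊hgt R m⌋ + 7 / 2 := by
  have h2 := two_mul_intCast_sq_le hM hm
  have hk := four_le_floor_hgt hM hm
  have hc := continuous_hgt R
  have hcc := continuous_clamp
  have hA : ∀ j ∈ Finset.range 7, area R (m, ⌊hgt R m⌋ - 3 + (j : ℤ)) =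
      ∫ s in (-(1 / 2) : ℝ)..(1 / 2),
        clamp (hgt R (m + s) - ((⌊hgt R m⌋ - 3 + (j : ℤ) : ℤ) : ℝ) + 1 / 2) := fun j _ =>
    area_eq_integral (by linarith) m (by omega)
  rw [columnSum, Finset.sum_congr rfl hA, ← intervalIntegral.integral_finsetSum
      (fun j _ => by apply Continuous.intervalIntegrable; fun_prop)]
  have : ∀ s ∈ Set.uIcc (-(1 / 2) : ℝ) (1 / 2), ∑ j ∈ Finset.range 7,
      clamp (hgt R (m + s) - ((⌊hgt R m⌋ - 3 + (j : ℤ) : ℤ) : ℝ) + 1 / 2) =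
      hgt R (m + s) + (- ⌊hgt R m⌋ + 7 / 2) := by
    intro s hs
    rw [Set.uIcc_of_le (by norm_num), Set.mem_Icc] at hs
    have h5 := abs_le.1 (abs_hgt_add_sub_le (s := s) (by linarith) h2
      (abs_le.2 ⟨by linarith, by linarith⟩))
    have f1 := Int.floor_le (hgt R m)
    have f2 := Int.lt_floor_add_one (hgt R m)
    rw [← sum_clamp_sub (hgt R (m + s) + (- ⌊hgt R m⌋ + 7 / 2)) 7 (by linarith)
      (by push_cast; linarith)]
    refine Finset.sum_congr rfl fun j _ => ?_
    congr 1
    push_cast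
    ring
  rw [intervalIntegral.integral_congr this, intervalIntegral.integral_add
    (by apply Continuous.intervalIntegrable; fun_prop) (by simp)]
  simp
  norm_num
  ring

/-- Exactly four of the seven points, those with `j ≤ 3`, lie in the disc, while the covered area is
`fract (hgt R m) + 7/2` up to `6 / R`; the difference is minus the sawtooth. -/
theorem abs_columnSum_countDefect_le (hR : 100 ≤ R) (hM : 2 * ((M : ℝ) + 10) ^ 2 ≤ R ^ 2) {m : ℤ}
    (hm : |m| ≤ M) : |columnSum R (countDefect R) m + saw (hgt R m)| ≤ 6 / R := by
  have h2 := two_mul_intCast_sq_le hM hm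
  have hk := four_le_floor_hgt hM hm
  have h4 := hgt_sq (R := R) (x := m) (by nlinarith [sq_nonneg (m : ℝ)])
  have e : columnSum R (countDefect R) m = 4 - columnSum R (area R) m := by
    simp only [columnSum, countDefect, Finset.sum_sub_distrib]
    congr 1
    have : ∀ j ∈ Finset.range 7, (if ‖latticePoint (m, ⌊hgt R m⌋ - 3 + (j : ℤ))‖ ≤ R
        then (1 : ℝ) else 0) = if j ≤ 3 then 1 else 0 := by
      intro j _
      refine if_congr ?_ rfl rfl
      rw [norm_latticePoint_le_iff (by linarith)]
      have : (m : ℝ) ^ 2 + ((⌊hgt R m⌋ - 3 + (j : ℤ) : ℤ) : ℝ) ^ 2 ≤ R ^ 2 ↔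
          ((⌊hgt R m⌋ - 3 + (j : ℤ) : ℤ) : ℝ) ^ 2 ≤ hgt R m ^ 2 := by
        rw [h4]; constructor <;> intro h <;> linarith
      rw [this, sq_le_sq₀ _ (hgt_nonneg _ _), ← Int.le_floor]
      · omega
      · have : 0 ≤ ⌊hgt R m⌋ - 3 + (j : ℤ) := by omega
        exact_mod_cast this
    rw [Finset.sum_congr rfl this, Finset.sum_boole,
      show ((Finset.range 7).filter (· ≤ 3)).card = 4 by decide]
    norm_num
  rw [e, columnSum_area hR hM hm, saw, Int.fract, ← abs_neg]
  have := integral_hgt_sub_le (by linarith) h2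
  convert! this using 2
  ring

theorem natCast_sub_abs_le {i : ℕ} (hi : i ∈ Finset.range (2 * M + 1)) :
    |((i : ℤ) - (M : ℤ))| ≤ M := by
  rw [Finset.mem_range] at hi
  rw [abs_le]; omega

theorem two_mul_natCast_sq_le (hM : 2 * ((M : ℝ) + 10) ^ 2 ≤ R ^ 2) :
    2 * (M : ℝ) ^ 2 ≤ R ^ 2 := by
  nlinarith [(Nat.cast_nonneg M : (0 : ℝ) ≤ M)]

theorem abs_sum_columnSum_countDefect_le (hR : 100 ≤ R) (hM : 2 * ((M : ℝ) + 10) ^ 2 ≤ R ^ 2) :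
    |∑ i ∈ Finset.range (2 * M + 1), columnSum R (countDefect R) (i - M)| ≤
      302 * R ^ (2 / 3 : ℝ) + 10 := by
  have h1 := abs_sum_saw_hgt_le (n := 2 * M + 1) (by linarith) (two_mul_natCast_sq_le hM) le_rfl 0
  simp only [sub_zero] at h1
  have h2 : |∑ i ∈ Finset.range (2 * M + 1),
      (columnSum R (countDefect R) (i - M) + saw (hgt R ((i : ℝ) - M)))| ≤ 10 := by
    refine (Finset.abs_sum_le_sum_abs _ _).trans ?_
    refine (Finset.sum_le_sum fun i hi => ?_).trans (b := ∑ i ∈ Finset.range (2 * M + 1), 6 / R) ?_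
    · have := abs_columnSum_countDefect_le hR hM (natCast_sub_abs_le hi)
      push_cast at this
      exact this
    · rw [Finset.sum_const, nsmul_eq_mul, Finset.card_range]
      have := natCast_two_mul_add_one_le (by linarith) (two_mul_natCast_sq_le hM)
      push_cast
      rw [mul_div_assoc', div_le_iff₀ (by linarith)]
      linarith
  rw [Finset.sum_add_distrib] at h2
  rw [abs_le] at *
  constructor <;> linarith [h1.1, h1.2, h2.1, h2.2]

end Columns

theorem one_le_rpow_two_thirds {R : ℝ} (hR : 100 ≤ R) : 1 ≤ R ^ (2 / 3 : ℝ) :=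
  Real.one_le_rpow (by linarith) (by norm_num)

/-- The Gauss circle problem with the exponent `2/3`. -/
theorem abs_card_closed_sub_le {R : ℝ} (hR : 100 ≤ R) {B : ℤ} (hB : R + 4 ≤ B) :
    |(((box B).filter fun l => ‖latticePoint l‖ ≤ R).card : ℝ) - Real.pi * R ^ 2| ≤
      5000 * R ^ (2 / 3 : ℝ) := by
  obtain ⟨M, hM, hM'⟩ := exists_column_bound hR
  have h1 := abs_sum_box_sub_columns_le (T := countDefect R) hR hM hM' hB
    (countDefect_rotate (by linarith)) (abs_countDefect_le R) (fun m n h =>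
      sq_bounds_of_mem_annulus (by linarith) (mem_annulus_of_countDefect_ne_zero h))
  have h2 := abs_sum_columnSum_countDefect_le hR hM
  have h3 : ∑ l ∈ box B, countDefect R l =
      (((box B).filter fun l => ‖latticePoint l‖ ≤ R).card : ℝ) - Real.pi * R ^ 2 := by
    simp only [countDefect, Finset.sum_sub_distrib]
    rw [sum_area_box (by linarith) (by linarith), Finset.sum_boole]
  rw [h3] at h1
  have h4 := one_le_rpow_two_thirds hR
  rw [abs_le] at *
  constructor <;> linarith [h1.1, h1.2, h2.1, h2.2]

/-- The open count lies between the closed counts at radii `R - 1/R` and `R`, whose discs differ in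
area by less than `8`. -/
theorem abs_card_open_sub_le {R : ℝ} (hR : 200 ≤ R) {B : ℤ} (hB : R + 4 ≤ B) :
    |(((box B).filter fun l => ‖latticePoint l‖ < R).card : ℝ) - Real.pi * R ^ 2| ≤
      5010 * R ^ (2 / 3 : ℝ) := by
  have hR0 : 0 < R := by linarith
  have hi : 1 / R ≤ 1 := by rw [div_le_one hR0]; linarith
  have hi0 : 0 < 1 / R := by positivity
  have h1 := abs_card_closed_sub_le (R := R) (by linarith) hB
  have h2 := abs_card_closed_sub_le (R := R - 1 / R) (by linarith) (B := B) (by linarith)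
  have h3 : ((box B).filter fun l => ‖latticePoint l‖ < R).card ≤
      ((box B).filter fun l => ‖latticePoint l‖ ≤ R).card :=
    Finset.card_le_card (Finset.monotone_filter_right _ fun l _ h => le_of_lt h)
  have h4 : ((box B).filter fun l => ‖latticePoint l‖ ≤ R - 1 / R).card ≤
      ((box B).filter fun l => ‖latticePoint l‖ < R).card :=
    Finset.card_le_card (Finset.monotone_filter_right _ fun l _ h => by linarith)
  have h3' : (((box B).filter fun l => ‖latticePoint l‖ < R).card : ℝ) ≤
      ((box B).filter fun l => ‖latticePoint l‖ ≤ R).card := by exact_mod_cast h3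
  have h4' : (((box B).filter fun l => ‖latticePoint l‖ ≤ R - 1 / R).card : ℝ) ≤
      ((box B).filter fun l => ‖latticePoint l‖ < R).card := by exact_mod_cast h4
  have h5 : (R - 1 / R) ^ (2 / 3 : ℝ) ≤ R ^ (2 / 3 : ℝ) :=
    Real.rpow_le_rpow (by linarith) (by linarith) (by norm_num)
  have h6 := one_le_rpow_two_thirds (R := R) (by linarith)
  have h7 : Real.pi * (R - 1 / R) ^ 2 ≥ Real.pi * R ^ 2 - 8 := by
    have : (R - 1 / R) ^ 2 = R ^ 2 - 2 + (1 / R) ^ 2 := by field_simp; ring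
    rw [this]
    nlinarith [Real.pi_pos, Real.pi_lt_four, sq_nonneg (1 / R)]
  rw [abs_le] at *
  constructor <;> linarith [h1.1, h1.2, h2.1, h2.2]

/-! ### The size of the annulus and the mean -/

theorem mem_Gam {R : ℝ} {l : ℤ × ℤ} : l ∈ Gam R ↔ latticePoint l ∈ annulus R := by
  simp [Gam, latticeAnnulus]

theorem mem_box_of_norm_le {R : ℝ} {B : ℤ} (hB : R ≤ B) {l : ℤ × ℤ} (h : ‖latticePoint l‖ ≤ R) :
    l ∈ box B := by
  obtain ⟨m, n⟩ := l
  have h0 : 0 ≤ R := (norm_nonneg _).trans h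
  rw [norm_latticePoint_le_iff h0] at h
  have h1 := abs_le_of_sq_le_sq (show (m : ℝ) ^ 2 ≤ R ^ 2 by nlinarith [sq_nonneg (n : ℝ)]) h0
  have h2 := abs_le_of_sq_le_sq (show (n : ℝ) ^ 2 ≤ R ^ 2 by nlinarith [sq_nonneg (m : ℝ)]) h0
  rw [abs_le] at h1 h2
  rw [mem_box]
  refine ⟨⟨?_, ?_⟩, ?_, ?_⟩ <;> rw [← Int.cast_le (R := ℝ)] <;> push_cast <;> linarith

theorem Gam_eq_filter {R : ℝ} {B : ℤ} (hB : R + 1 ≤ B) :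
    Gam R = (box B).filter fun l => R - 1 / √2 < ‖latticePoint l‖ ∧
      ‖latticePoint l‖ < R + 1 / √2 := by
  ext l
  rw [Finset.mem_filter, mem_Gam]
  refine ⟨fun h => ⟨mem_box_of_norm_le hB ?_, h⟩, fun h => h.2⟩
  have := one_div_sqrt_two_lt_one
  linarith [h.2]

section Asymptotics

variable {R : ℝ} {B : ℤ}

theorem K_add_card (hB : R + 1 ≤ B) :
    (K R : ℝ) + ((box B).filter fun l => ‖latticePoint l‖ ≤ R - 1 / √2).card =
      ((box B).filter fun l => ‖latticePoint l‖ < R + 1 / √2).card := by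
  have h0 := one_div_sqrt_two_pos
  rw [K, Gam_eq_filter hB, ← Nat.cast_add]
  congr 1
  rw [← Finset.card_union_of_disjoint]
  · congr 1
    ext l
    simp only [Finset.mem_union, Finset.mem_filter]
    constructor
    · rintro (⟨h, h1, h2⟩ | ⟨h, h1⟩)
      · exact ⟨h, h2⟩
      · exact ⟨h, by linarith⟩
    · rintro ⟨h, h1⟩
      rcases lt_or_ge (R - 1 / √2) ‖latticePoint l‖ with h2 | h2
      · exact Or.inl ⟨h, h2, h1⟩
      · exact Or.inr ⟨h, h2⟩
  · rw [Finset.disjoint_left]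
    intro l h1 h2
    rw [Finset.mem_filter] at h1 h2
    linarith [h1.2.1, h2.2]

/-- Off the annulus the area is the indicator of `‖l‖ ≤ R - 1/√2`, so the left side is the sum of
all areas. -/
theorem sum_area_add_card (hR : 0 < R) (hB : R + 1 ≤ B) :
    ∑ l ∈ Gam R, area R l + ((box B).filter fun l => ‖latticePoint l‖ ≤ R - 1 / √2).card =
      Real.pi * R ^ 2 := by
  rw [← sum_area_box hR hB, Gam_eq_filter hB, Finset.sum_filter, ← Finset.sum_boole,
    ← Finset.sum_add_distrib]
  refine Finset.sum_congr rfl fun l _ => ?_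
  rcases le_or_gt ‖latticePoint l‖ (R - 1 / √2) with h | h
  · rw [if_neg (fun h2 => by linarith [h2.1]), if_pos h, area_eq_one h, zero_add]
  · rw [if_neg (not_le.2 h), add_zero]
    split_ifs with h2
    · rfl
    · rw [not_and] at h2
      exact (area_eq_zero (not_lt.1 (h2 h))).symm

/-- The areas of the two bounding discs differ by `2√2πR`, and their average is `πR² + π/2`. The
second identity makes the sum of the areas agree with `K R / 2`: their difference is `πR²` minus the
average of the two counts. -/
theorem card_estimates (hR : 300 ≤ R) :
    |(K R : ℝ) - 2 * √2 * Real.pi * R| ≤ 20000 * R ^ (2 / 3 : ℝ) ∧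
      |∑ l ∈ Gam R, area R l - K R / 2| ≤ 20000 * R ^ (2 / 3 : ℝ) := by
  have hR0 : 0 < R := by linarith
  obtain ⟨B, hB⟩ := exists_int_gt (R + 10)
  have q0 := one_div_sqrt_two_pos
  have q1 := one_div_sqrt_two_lt_one
  have h1 := K_add_card (R := R) (B := B) (by linarith)
  have h2 := sum_area_add_card (R := R) (B := B) hR0 (by linarith)
  have h3 := abs_card_closed_sub_le (R := R - 1 / √2) (by linarith) (B := B) (by linarith)
  have h4 := abs_card_open_sub_le (R := R + 1 / √2) (by linarith) (B := B) (by linarith)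
  have h5 : (R - 1 / √2) ^ (2 / 3 : ℝ) ≤ R ^ (2 / 3 : ℝ) :=
    Real.rpow_le_rpow (by linarith) (by linarith) (by norm_num)
  have h6 : (R + 1 / √2) ^ (2 / 3 : ℝ) ≤ 2 * R ^ (2 / 3 : ℝ) := by
    calc (R + 1 / √2) ^ (2 / 3 : ℝ) ≤ (2 * R) ^ (2 / 3 : ℝ) :=
          Real.rpow_le_rpow (by linarith) (by linarith) (by norm_num)
      _ = 2 ^ (2 / 3 : ℝ) * R ^ (2 / 3 : ℝ) := Real.mul_rpow (by norm_num) hR0.le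
      _ ≤ 2 * R ^ (2 / 3 : ℝ) := by
        gcongr
        calc (2 : ℝ) ^ (2 / 3 : ℝ) ≤ 2 ^ (1 : ℝ) :=
              Real.rpow_le_rpow_of_exponent_le (by norm_num) (by norm_num)
          _ = 2 := Real.rpow_one 2
  have h7 := one_le_rpow_two_thirds (R := R) (by linarith)
  have hs : √(2 : ℝ) * √2 = 2 := Real.mul_self_sqrt (by norm_num)
  have hs0 : 0 < √(2 : ℝ) := by positivity
  have hq : 1 / √(2 : ℝ) = √2 / 2 := by rw [div_eq_div_iff hs0.ne' two_ne_zero]; linarith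
  have e1 : Real.pi * (R + 1 / √2) ^ 2 - Real.pi * (R - 1 / √2) ^ 2 =
      2 * √2 * Real.pi * R := by rw [hq]; ring
  have e2 : Real.pi * (R + 1 / √2) ^ 2 + Real.pi * (R - 1 / √2) ^ 2 =
      2 * (Real.pi * R ^ 2) + Real.pi := by
    rw [hq]; linear_combination Real.pi / 2 * hs
  have hp := Real.pi_pos
  have hp4 := Real.pi_lt_four
  rw [abs_le] at h3 h4
  constructor <;> rw [abs_le] <;> constructor <;> linarith [h3.1, h3.2, h4.1, h4.2]

end Asymptotics

theorem abs_mean_sub_half_le_half (R : ℝ) : |mean R - 1 / 2| ≤ 1 / 2 := by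
  have h0 : 0 ≤ mean R :=
    mul_nonneg (by positivity) (Finset.sum_nonneg fun l _ => area_nonneg R l)
  have h1 : mean R ≤ 1 := by
    have : ∑ l ∈ Gam R, area R l ≤ K R := by
      refine (Finset.sum_le_sum fun l _ => area_le_one R l).trans ?_
      simp [K]
    calc mean R ≤ (1 / (K R : ℝ)) * K R := by rw [mean]; gcongr
      _ ≤ 1 := by rw [one_div]; exact inv_mul_le_one
  rw [abs_le]; constructor <;> linarith

theorem rpow_eq_mul_rpow {R : ℝ} (hR : 0 < R) :
    R ^ (2 / 3 : ℝ) = R * R ^ (-(1 / 3) : ℝ) := by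
  nth_rewrite 2 [← Real.rpow_one R]
  rw [← Real.rpow_add hR]; norm_num

theorem rpow_neg_third_threshold : ((20000 : ℝ) ^ 3) ^ (-(1 / 3) : ℝ) = 1 / 20000 := by
  rw [← Real.rpow_natCast, ← Real.rpow_mul (by norm_num)]
  norm_num

theorem abs_mean_sub_half_le {R : ℝ} (hR : 0 < R) :
    |mean R - 1 / 2| ≤ 20000 * R ^ (-(1 / 3) : ℝ) := by
  -- At this threshold `20000 * R^(-1/3) = 1`. Below it the trivial bound `1/2` suffices; above it
  -- the error in `K R` is at most `R`, which gives `K R ≥ R`.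
  rcases le_or_gt R (20000 ^ 3) with h | h
  · refine (abs_mean_sub_half_le_half R).trans ?_
    have := Real.rpow_le_rpow_of_nonpos hR h (show (-(1 / 3) : ℝ) ≤ 0 by norm_num)
    rw [rpow_neg_third_threshold] at this
    linarith
  · obtain ⟨h1, h2⟩ := card_estimates (R := R) (by linarith)
    have h3 := Real.rpow_le_rpow_of_nonpos (by norm_num) h.le
      (show (-(1 / 3) : ℝ) ≤ 0 by norm_num)
    rw [rpow_neg_third_threshold] at h3
    have h4 : 20000 * R ^ (2 / 3 : ℝ) ≤ R := by
      rw [rpow_eq_mul_rpow hR]; nlinarith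
    have h5 : 1 ≤ √(2 : ℝ) := Real.one_le_sqrt.2 (by norm_num)
    have h6 : R ≤ K R := by
      have a1 := (abs_le.1 h1).1
      have a2 : 2 * R ≤ 2 * √2 * Real.pi * R := by
        have : 1 ≤ √2 * Real.pi := by nlinarith [Real.pi_gt_three]
        nlinarith
      linarith
    have hK : (0 : ℝ) < K R := by linarith
    have e : mean R - 1 / 2 = (∑ l ∈ Gam R, area R l - K R / 2) / K R := by
      rw [mean]; field_simp
    rw [e, abs_div, abs_of_pos hK, div_le_iff₀ hK]
    refine h2.trans ?_
    rw [rpow_eq_mul_rpow hR]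
    have : 0 ≤ R ^ (-(1 / 3) : ℝ) := by positivity
    nlinarith

theorem tendsto_rpow_neg_third : Tendsto (fun R : ℝ => R ^ (-(1 / 3) : ℝ)) atTop (𝓝 0) :=
  tendsto_rpow_neg_atTop (by norm_num)

theorem tendsto_mean : Tendsto mean atTop (𝓝 (1 / 2)) := by
  rw [tendsto_iff_norm_sub_tendsto_zero]
  have := tendsto_rpow_neg_third.const_mul 20000
  rw [mul_zero] at this
  refine squeeze_zero' (Eventually.of_forall fun _ => norm_nonneg _) ?_ this
  filter_upwards [eventually_gt_atTop 0] with R hR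
  exact abs_mean_sub_half_le hR

theorem tendsto_K_div : Tendsto (fun R => (K R : ℝ) / R) atTop (𝓝 (2 * √2 * Real.pi)) := by
  rw [tendsto_iff_norm_sub_tendsto_zero]
  have := tendsto_rpow_neg_third.const_mul 20000
  rw [mul_zero] at this
  refine squeeze_zero' (Eventually.of_forall fun _ => norm_nonneg _) ?_ this
  filter_upwards [eventually_ge_atTop 300] with R hR
  have hR0 : 0 < R := by linarith
  have e : (K R : ℝ) / R - 2 * √2 * Real.pi = ((K R : ℝ) - 2 * √2 * Real.pi * R) / R := by
    field_simp
  rw [e, Real.norm_eq_abs, abs_div, abs_of_pos hR0, div_le_iff₀ hR0]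
  refine (card_estimates hR).1.trans (le_of_eq ?_)
  rw [rpow_eq_mul_rpow hR0]; ring

/-! ### Equidistribution against slowly varying weights -/

theorem sum_range_mul_eq_by_parts (w z : ℕ → ℝ) (n : ℕ) :
    ∑ i ∈ Finset.range (n + 1), w i * z i = w n * ∑ i ∈ Finset.range (n + 1), z i -
      ∑ i ∈ Finset.range n, (w (i + 1) - w i) * ∑ k ∈ Finset.range (i + 1), z k := by
  induction n with
  | zero => simp
  | succ n ih =>
    rw [Finset.sum_range_succ, ih, Finset.sum_range_succ z (n + 1),
      Finset.sum_range_succ (fun i => (w (i + 1) - w i) * ∑ k ∈ Finset.range (i + 1), z k) n]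
    ring

/-- Abel's inequality for weights of bounded variation. -/
theorem abs_sum_range_mul_le {w z : ℕ → ℝ} {n : ℕ} {b v d : ℝ} (hb : |w n| ≤ b)
    (hv : ∑ i ∈ Finset.range n, |w (i + 1) - w i| ≤ v)
    (hd : ∀ k ≤ n + 1, |∑ i ∈ Finset.range k, z i| ≤ d) :
    |∑ i ∈ Finset.range (n + 1), w i * z i| ≤ (b + v) * d := by
  have hd0 : 0 ≤ d := (abs_nonneg _).trans (hd 0 (by omega))
  rw [sum_range_mul_eq_by_parts]
  refine (abs_sub _ _).trans ?_
  rw [add_mul, abs_mul]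
  apply add_le_add
  · exact mul_le_mul hb (hd _ le_rfl) (abs_nonneg _) ((abs_nonneg _).trans hb)
  · refine (Finset.abs_sum_le_sum_abs _ _).trans ?_
    refine (Finset.sum_le_sum fun i hi => ?_).trans
      (b := ∑ i ∈ Finset.range n, |w (i + 1) - w i| * d) ?_
    · rw [abs_mul]
      have : i < n := Finset.mem_range.1 hi
      exact mul_le_mul_of_nonneg_left (hd _ (by omega)) (abs_nonneg _)
    · rw [← Finset.sum_mul]
      exact mul_le_mul_of_nonneg_right hv hd0

theorem continuous_of_abs_sub_le {g : ℝ → ℝ} {L : ℝ} (hg : ∀ u v, |g u - g v| ≤ L * |u - v|) :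
    Continuous g := by
  have hL : 0 ≤ L := by
    have := (abs_nonneg _).trans (hg 1 0)
    simpa using this
  have : LipschitzWith ⟨L, hL⟩ g := LipschitzWith.of_dist_le_mul fun u v => by
    rw [Real.dist_eq, Real.dist_eq]; exact hg u v
  exact this.continuous

theorem abs_riemann_sum_sub_integral_le {g : ℝ → ℝ} {L : ℝ}
    (hg : ∀ u v, |g u - g v| ≤ L * |u - v|) {J : ℕ} (hJ : 0 < J) :
    |∑ j ∈ Finset.range J, 1 / (J : ℝ) * g (j / J) - ∫ u in (0 : ℝ)..1, g u| ≤ L / J := by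
  have hc := continuous_of_abs_sub_le hg
  have hJ' : (0 : ℝ) < J := by exact_mod_cast hJ
  have hL : 0 ≤ L := by
    have := (abs_nonneg _).trans (hg 1 0)
    simpa using this
  have h1 := intervalIntegral.sum_integral_adjacent_intervals (f := g) (μ := volume)
    (a := fun j : ℕ => (j : ℝ) / J) (n := J) (fun k _ => hc.intervalIntegrable _ _)
  simp only [Nat.cast_zero, zero_div, div_self hJ'.ne'] at h1
  rw [← h1, ← Finset.sum_sub_distrib]
  refine (Finset.abs_sum_le_sum_abs _ _).trans ?_
  refine (Finset.sum_le_sum fun j _ => ?_).trans (b := ∑ j ∈ Finset.range J, L / J * (1 / J)) ?_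
  · have hle : (j : ℝ) / J ≤ ((j + 1 : ℕ) : ℝ) / J := by gcongr; simp
    have e : 1 / (J : ℝ) * g (j / J) = ∫ _u in ((j : ℝ) / J)..(((j + 1 : ℕ) : ℝ) / J), g (j / J) := by
      rw [intervalIntegral.integral_const, smul_eq_mul]
      push_cast
      field_simp
      ring
    rw [e, ← intervalIntegral.integral_sub (by simp) (hc.intervalIntegrable _ _)]
    have := intervalIntegral.norm_integral_le_of_norm_le_const (a := (j : ℝ) / J)
      (b := ((j + 1 : ℕ) : ℝ) / J) (C := L / J) (f := fun u => g (j / J) - g u) (by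
        intro u hu
        rw [Set.uIoc_of_le hle] at hu
        refine (hg _ _).trans ?_
        rw [div_eq_mul_one_div L]
        apply mul_le_mul_of_nonneg_left _ hL
        rw [abs_sub_comm, abs_of_nonneg (by linarith [hu.1])]
        have := hu.2
        push_cast at this
        rw [add_div] at this
        linarith)
    rw [Real.norm_eq_abs] at this
    refine this.trans (le_of_eq ?_)
    congr 1
    rw [abs_of_nonneg (by linarith)]
    push_cast
    ring
  · rw [Finset.sum_const, Finset.card_range, nsmul_eq_mul]
    apply le_of_eq
    field_simp

/-- The indicator of `fract x ∈ [j / J, (j + 1) / J)`, written with the sawtooth function. -/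
noncomputable def binIndicator (J j : ℕ) (x : ℝ) : ℝ :=
  1 / J + (saw (x - ((j + 1 : ℕ) : ℝ) / J) - saw (x - (j : ℝ) / J))

/-- A shift by `c` in `[0, 1]` lowers the fractional part by `c`, or by `c - 1` if it wraps. The two
shifts wrap differently exactly when `fract x` lies in the bin. -/
theorem binIndicator_eq {J j : ℕ} (hj : j < J) (x : ℝ) :
    binIndicator J j x =
      if (j : ℝ) / J ≤ Int.fract x ∧ Int.fract x < ((j + 1 : ℕ) : ℝ) / J then 1 else 0 := by
  have hJ : (0 : ℝ) < J := by exact_mod_cast (Nat.zero_le j).trans_lt hj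
  have hb : ((j + 1 : ℕ) : ℝ) / J ≤ 1 := by
    rw [div_le_one hJ]; exact_mod_cast hj
  have hab : ((j + 1 : ℕ) : ℝ) / J = (j : ℝ) / J + 1 / J := by push_cast; ring
  have h0 : 0 ≤ (j : ℝ) / J := by positivity
  have hJi : 0 < 1 / (J : ℝ) := by positivity
  rw [binIndicator, saw, saw]
  by_cases h1 : (j : ℝ) / J ≤ Int.fract x
  · rw [fract_sub_eq_of_le h0 h1]
    by_cases h2 : Int.fract x < ((j + 1 : ℕ) : ℝ) / J
    · rw [fract_sub_eq_of_lt hb h2, if_pos ⟨h1, h2⟩]; linarith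
    · rw [fract_sub_eq_of_le (by linarith) (not_lt.1 h2), if_neg (fun h => h2 h.2)]; linarith
  · have h2 : Int.fract x < ((j + 1 : ℕ) : ℝ) / J := by linarith
    rw [fract_sub_eq_of_lt hb h2, fract_sub_eq_of_lt (by linarith) (not_le.1 h1),
      if_neg (fun h => h1 h.1)]
    linarith

theorem sum_binIndicator {J : ℕ} (hJ : 0 < J) (x : ℝ) :
    ∑ j ∈ Finset.range J, binIndicator J j x = 1 := by
  have hJ' : (0 : ℝ) < J := by exact_mod_cast hJ
  simp only [binIndicator]
  rw [Finset.sum_add_distrib, Finset.sum_range_sub (fun j : ℕ => saw (x - (j : ℝ) / J)),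
    Finset.sum_const, Finset.card_range, nsmul_eq_mul, div_self hJ'.ne', saw, saw,
    Int.fract_sub_one]
  simp
  field_simp

theorem abs_sub_sum_binIndicator_le {g : ℝ → ℝ} {L : ℝ}
    (hg : ∀ u v, |g u - g v| ≤ L * |u - v|) {J : ℕ} (hJ : 0 < J) (x : ℝ) :
    |g (Int.fract x) - ∑ j ∈ Finset.range J, g (j / J) * binIndicator J j x| ≤ L / J := by
  have hJ' : (0 : ℝ) < J := by exact_mod_cast hJ
  have hL : 0 ≤ L := by
    have := (abs_nonneg _).trans (hg 1 0)
    simpa using this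
  have h1 : g (Int.fract x) - ∑ j ∈ Finset.range J, g (j / J) * binIndicator J j x =
      ∑ j ∈ Finset.range J, (g (Int.fract x) - g (j / J)) * binIndicator J j x := by
    simp only [sub_mul]
    rw [Finset.sum_sub_distrib, ← Finset.mul_sum, sum_binIndicator hJ, mul_one]
  have h2 : L / J = ∑ j ∈ Finset.range J, L / J * binIndicator J j x := by
    rw [← Finset.mul_sum, sum_binIndicator hJ, mul_one]
  rw [h1, h2]
  refine (Finset.abs_sum_le_sum_abs _ _).trans (Finset.sum_le_sum fun j hj => ?_)
  rw [binIndicator_eq (Finset.mem_range.1 hj)]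
  split_ifs with h
  · rw [mul_one, mul_one]
    refine (hg _ _).trans ?_
    rw [div_eq_mul_one_div L]
    apply mul_le_mul_of_nonneg_left _ hL
    rw [abs_of_nonneg (by linarith [h.1])]
    have := h.2
    push_cast at this
    rw [add_div] at this
    linarith
  · simp

/-- Quantitative equidistribution: if sawtooth sums along `x` are small, then averages along
`fract (x i)` of Lipschitz functions of slowly varying shape are close to their integrals. -/
theorem abs_sum_fract_sub_sum_integral_le {x : ℕ → ℝ} {n : ℕ} {d b v L : ℝ} {g : ℕ → ℝ → ℝ}
    (hd : ∀ k ≤ n + 1, ∀ c, |∑ i ∈ Finset.range k, saw (x i - c)| ≤ d)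
    (hg : ∀ i u v, |g i u - g i v| ≤ L * |u - v|) (hb : ∀ i u, |g i u| ≤ b)
    (hv : ∀ u, ∑ i ∈ Finset.range n, |g (i + 1) u - g i u| ≤ v) {J : ℕ} (hJ : 0 < J) :
    |∑ i ∈ Finset.range (n + 1), g i (Int.fract (x i)) -
      ∑ i ∈ Finset.range (n + 1), ∫ u in (0 : ℝ)..1, g i u| ≤
      2 * (n + 1) * L / J + 2 * J * ((b + v) * d) := by
  have hJ' : (0 : ℝ) < J := by exact_mod_cast hJ
  have h1 : |∑ i ∈ Finset.range (n + 1), (g i (Int.fract (x i)) -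
      ∑ j ∈ Finset.range J, g i (j / J) * binIndicator J j (x i))| ≤ (n + 1) * (L / J) := by
    refine (Finset.abs_sum_le_sum_abs _ _).trans ?_
    refine (Finset.sum_le_sum fun i _ => abs_sub_sum_binIndicator_le (hg i) hJ (x i)).trans ?_
    rw [Finset.sum_const, Finset.card_range, nsmul_eq_mul]
    push_cast
    exact le_rfl
  have h2 : |∑ i ∈ Finset.range (n + 1), (∑ j ∈ Finset.range J, 1 / (J : ℝ) * g i (j / J) -
      ∫ u in (0 : ℝ)..1, g i u)| ≤ (n + 1) * (L / J) := by
    refine (Finset.abs_sum_le_sum_abs _ _).trans ?_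
    refine (Finset.sum_le_sum fun i _ => abs_riemann_sum_sub_integral_le (hg i) hJ).trans ?_
    rw [Finset.sum_const, Finset.card_range, nsmul_eq_mul]
    push_cast
    exact le_rfl
  -- Once the value is frozen at `j / J`, the weight depends on `i` alone and has bounded variation,
  -- so Abel's inequality applies to each of the two sawtooths of a bin.
  have h3 : |∑ i ∈ Finset.range (n + 1), ∑ j ∈ Finset.range J,
      g i (j / J) * (saw (x i - ((j + 1 : ℕ) : ℝ) / J) - saw (x i - (j : ℝ) / J))| ≤
      2 * J * ((b + v) * d) := by
    rw [Finset.sum_comm]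
    refine (Finset.abs_sum_le_sum_abs _ _).trans ?_
    refine (Finset.sum_le_sum fun j _ => ?_).trans
      (b := ∑ j ∈ Finset.range J, 2 * ((b + v) * d)) ?_
    · simp only [mul_sub]
      rw [Finset.sum_sub_distrib]
      refine (abs_sub _ _).trans ?_
      have e := fun c => abs_sum_range_mul_le (w := fun i => g i ((j : ℝ) / J))
        (z := fun i => saw (x i - c)) (n := n) (hb n _) (hv _) (fun k hk => hd k hk c)
      have e1 := e (((j + 1 : ℕ) : ℝ) / J)
      have e2 := e ((j : ℝ) / J)
      linarith
    · rw [Finset.sum_const, Finset.card_range, nsmul_eq_mul]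
      apply le_of_eq; ring
  have e : ∑ i ∈ Finset.range (n + 1), g i (Int.fract (x i)) -
      ∑ i ∈ Finset.range (n + 1), ∫ u in (0 : ℝ)..1, g i u =
      ∑ i ∈ Finset.range (n + 1), (g i (Int.fract (x i)) -
        ∑ j ∈ Finset.range J, g i (j / J) * binIndicator J j (x i)) +
      ∑ i ∈ Finset.range (n + 1), (∑ j ∈ Finset.range J, 1 / (J : ℝ) * g i (j / J) -
        ∫ u in (0 : ℝ)..1, g i u) +
      ∑ i ∈ Finset.range (n + 1), ∑ j ∈ Finset.range J,
        g i (j / J) * (saw (x i - ((j + 1 : ℕ) : ℝ) / J) - saw (x i - (j : ℝ) / J)) := by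
    rw [← Finset.sum_sub_distrib, ← Finset.sum_add_distrib, ← Finset.sum_add_distrib]
    refine Finset.sum_congr rfl fun i _ => ?_
    have : ∑ j ∈ Finset.range J, g i (j / J) * binIndicator J j (x i) =
        ∑ j ∈ Finset.range J, 1 / (J : ℝ) * g i (j / J) + ∑ j ∈ Finset.range J,
          g i (j / J) * (saw (x i - ((j + 1 : ℕ) : ℝ) / J) - saw (x i - (j : ℝ) / J)) := by
      rw [← Finset.sum_add_distrib]
      refine Finset.sum_congr rfl fun j _ => ?_
      rw [binIndicator]; ring
    rw [this]
    ring
  rw [e]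
  refine (abs_add_le _ _).trans (add_le_add ((abs_add_le _ _).trans ?_) h3)
  have : 2 * (n + 1) * L / J = (n + 1) * (L / J) + (n + 1) * (L / J) := by ring
  rw [this]
  exact add_le_add h1 h2

/-! ### Unit squares cut by a line -/

/-- The area of a unit square below a line of slope `-τ` at height `v` above its centre. -/
noncomputable def coverage (v τ : ℝ) : ℝ :=
  ∫ s in (-(1 / 2) : ℝ)..(1 / 2), clamp (v - s * τ + 1 / 2)

/-- The product of the two areas cut from a unit square by a line. -/
noncomputable def spread (v τ : ℝ) : ℝ := coverage v τ * (1 - coverage v τ)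

theorem intervalIntegrable_clamp (v τ a b : ℝ) :
    IntervalIntegrable (fun s => clamp (v - s * τ + 1 / 2)) volume a b := by
  have := continuous_clamp
  apply Continuous.intervalIntegrable; fun_prop

theorem coverage_nonneg (v τ : ℝ) : 0 ≤ coverage v τ :=
  intervalIntegral.integral_nonneg (by norm_num) fun _ _ => clamp_nonneg _

theorem coverage_le_one (v τ : ℝ) : coverage v τ ≤ 1 := by
  have := intervalIntegral.integral_mono_on (a := (-(1 / 2) : ℝ)) (b := 1 / 2) (by norm_num)
    (intervalIntegrable_clamp v τ _ _) (g := fun _ => (1 : ℝ)) (by simp)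
    (fun s _ => clamp_le_one _)
  rw [intervalIntegral.integral_const] at this
  refine this.trans (le_of_eq ?_)
  norm_num

theorem abs_coverage_sub_le (v w τ σ : ℝ) :
    |coverage v τ - coverage w σ| ≤ |v - w| + |τ - σ| := by
  rw [coverage, coverage, ← intervalIntegral.integral_sub (intervalIntegrable_clamp _ _ _ _)
    (intervalIntegrable_clamp _ _ _ _)]
  have := intervalIntegral.norm_integral_le_of_norm_le_const (a := (-(1 / 2) : ℝ)) (b := 1 / 2)
    (C := |v - w| + |τ - σ|)
    (f := fun s => clamp (v - s * τ + 1 / 2) - clamp (w - s * σ + 1 / 2)) (by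
      intro s hs
      rw [Set.uIoc_of_le (by norm_num)] at hs
      refine (abs_clamp_sub_le _ _).trans ?_
      have e : v - s * τ + 1 / 2 - (w - s * σ + 1 / 2) = (v - w) - s * (τ - σ) := by ring
      rw [e]
      refine (abs_sub _ _).trans ?_
      rw [abs_mul]
      have : |s| ≤ 1 := abs_le.2 ⟨by linarith [hs.1], by linarith [hs.2]⟩
      nlinarith [abs_nonneg (τ - σ)])
  rw [Real.norm_eq_abs] at this
  refine this.trans (le_of_eq ?_)
  norm_num

theorem abs_mul_one_sub_sub_le {p q : ℝ} (hp : 0 ≤ p) (hp1 : p ≤ 1) (hq : 0 ≤ q) (hq1 : q ≤ 1) :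
    |p * (1 - p) - q * (1 - q)| ≤ |p - q| := by
  have : p * (1 - p) - q * (1 - q) = (p - q) * (1 - p - q) := by ring
  rw [this, abs_mul]
  have : |1 - p - q| ≤ 1 := abs_le.2 ⟨by linarith, by linarith⟩
  nlinarith [abs_nonneg (p - q)]

theorem abs_spread_sub_le (v w τ σ : ℝ) : |spread v τ - spread w σ| ≤ |v - w| + |τ - σ| :=
  (abs_mul_one_sub_sub_le (coverage_nonneg _ _) (coverage_le_one _ _) (coverage_nonneg _ _)
    (coverage_le_one _ _)).trans (abs_coverage_sub_le _ _ _ _)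

theorem abs_spread_le_one (v τ : ℝ) : |spread v τ| ≤ 1 := by
  have h0 := coverage_nonneg v τ
  have h1 := coverage_le_one v τ
  rw [spread, abs_le]; constructor <;> nlinarith

theorem continuous_spread (τ : ℝ) : Continuous fun v => spread v τ :=
  continuous_of_abs_sub_le (L := 1) fun u v => by
    simpa using abs_spread_sub_le u v τ τ

theorem coverage_neg_right (v τ : ℝ) : coverage v (-τ) = coverage v τ := by
  have := intervalIntegral.integral_comp_neg (a := (-(1 / 2) : ℝ)) (b := 1 / 2)
    (fun s => clamp (v - s * τ + 1 / 2))
  rw [neg_neg] at this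
  rw [coverage, coverage, ← this]
  simp only [mul_neg, neg_mul]

theorem clamp_one_sub (y : ℝ) : clamp (1 - y) = 1 - clamp y := by
  rw [clamp, clamp]
  rcases le_total y 0 with h | h
  · rw [min_eq_right (by linarith), min_eq_left (by linarith : y ≤ 1), max_eq_left h,
      max_eq_right zero_le_one, sub_zero]
  · rcases le_total y 1 with h1 | h1
    · rw [min_eq_left (by linarith), min_eq_left h1, max_eq_right h, max_eq_right (by linarith)]
    · rw [min_eq_left (by linarith), min_eq_right h1, max_eq_right zero_le_one,
        max_eq_left (by linarith), sub_self]

/-- A half turn about the centre of the square exchanges the two sides of the line. -/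
theorem coverage_neg_left (v τ : ℝ) : coverage (-v) τ = 1 - coverage v τ := by
  have e : ∫ _s in (-(1 / 2) : ℝ)..(1 / 2), (1 : ℝ) = 1 := by
    rw [intervalIntegral.integral_const]; norm_num
  rw [← coverage_neg_right (-v), eq_sub_iff_add_eq, ← e, coverage, coverage,
    ← intervalIntegral.integral_add (intervalIntegrable_clamp _ _ _ _)
    (intervalIntegrable_clamp _ _ _ _)]
  refine intervalIntegral.integral_congr fun s _ => ?_
  have := clamp_one_sub (v - s * τ + 1 / 2)
  rw [show -v - s * -τ + 1 / 2 = 1 - (v - s * τ + 1 / 2) by ring, this, sub_add_cancel]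

theorem spread_neg_left (v τ : ℝ) : spread (-v) τ = spread v τ := by
  rw [spread, coverage_neg_left, spread]; ring

theorem spread_neg_right (v τ : ℝ) : spread v (-τ) = spread v τ := by
  rw [spread, coverage_neg_right, spread]

theorem spread_abs_right (v τ : ℝ) : spread v |τ| = spread v τ := by
  rcases abs_choice τ with h | h <;> rw [h]
  exact spread_neg_right v τ

theorem clamp_of_mem {y : ℝ} (h0 : 0 ≤ y) (h1 : y ≤ 1) : clamp y = y := by
  rw [clamp, min_eq_left h1, max_eq_right h0]

theorem clamp_of_one_le {y : ℝ} (h : 1 ≤ y) : clamp y = 1 := by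
  rw [clamp, min_eq_right h, max_eq_right zero_le_one]

section Spread

variable {v τ : ℝ}

/-- The line crosses both vertical sides, so the region below it is a trapezoid. -/
theorem coverage_inner (hτ : 0 ≤ τ) (h0 : 0 ≤ v) (h1 : v ≤ (1 - τ) / 2) :
    coverage v τ = v + 1 / 2 := by
  have : ∫ s in (-(1 / 2) : ℝ)..(1 / 2), clamp (v - s * τ + 1 / 2) =
      ∫ s in (-(1 / 2) : ℝ)..(1 / 2), ((v + 1 / 2) - s * τ) := by
    refine intervalIntegral.integral_congr fun s hs => ?_
    rw [Set.uIcc_of_le (by norm_num), Set.mem_Icc] at hs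
    rw [clamp_of_mem (by nlinarith) (by nlinarith)]
    ring
  rw [coverage, this, intervalIntegral.integral_sub (by simp)
    (by apply Continuous.intervalIntegrable; fun_prop), intervalIntegral.integral_const,
    intervalIntegral.integral_mul_const, integral_id]
  simp
  norm_num

/-- The line cuts off the upper right corner. The missing triangle has vertical leg `(1 + τ)/2 - v`
and slope `τ`; `c` is the abscissa where the line meets the top side. -/
theorem coverage_middle (hτ : 0 < τ) (hτ1 : τ ≤ 1) (h0 : (1 - τ) / 2 ≤ v) (h1 : v ≤ (1 + τ) / 2) :
    coverage v τ = 1 - ((1 + τ) / 2 - v) ^ 2 / (2 * τ) := by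
  set c := (v - 1 / 2) / τ with hc
  have hcτ : c * τ = v - 1 / 2 := by rw [hc]; field_simp
  have hc0 : -(1 / 2) ≤ c := by rw [hc, le_div_iff₀ hτ]; linarith
  have hc1 : c ≤ 1 / 2 := by rw [hc, div_le_iff₀ hτ]; linarith
  rw [coverage, ← intervalIntegral.integral_add_adjacent_intervals
    (intervalIntegrable_clamp v τ (-(1 / 2)) c) (intervalIntegrable_clamp v τ c (1 / 2))]
  have e1 : ∫ s in (-(1 / 2) : ℝ)..c, clamp (v - s * τ + 1 / 2) = c + 1 / 2 := by
    have : ∫ s in (-(1 / 2) : ℝ)..c, clamp (v - s * τ + 1 / 2) =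
        ∫ s in (-(1 / 2) : ℝ)..c, (1 : ℝ) := by
      refine intervalIntegral.integral_congr fun s hs => ?_
      rw [Set.uIcc_of_le hc0, Set.mem_Icc] at hs
      exact clamp_of_one_le (by nlinarith)
    rw [this, intervalIntegral.integral_const]
    simp
  have e2 : ∫ s in c..(1 / 2), clamp (v - s * τ + 1 / 2) =
      (1 / 2 - c) * (v + 1 / 2) - ((1 / 2) ^ 2 - c ^ 2) / 2 * τ := by
    have : ∫ s in c..(1 / 2), clamp (v - s * τ + 1 / 2) =
        ∫ s in c..(1 / 2), ((v + 1 / 2) - s * τ) := by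
      refine intervalIntegral.integral_congr fun s hs => ?_
      rw [Set.uIcc_of_le hc1, Set.mem_Icc] at hs
      rw [clamp_of_mem (by nlinarith) (by nlinarith)]
      ring
    rw [this, intervalIntegral.integral_sub (by simp)
      (by apply Continuous.intervalIntegrable; fun_prop), intervalIntegral.integral_const,
      intervalIntegral.integral_mul_const, integral_id, smul_eq_mul]
  have hv : v = c * τ + 1 / 2 := by linarith
  rw [e1, e2, hv]
  field_simp
  ring

theorem coverage_outer (hτ : 0 ≤ τ) (h1 : (1 + τ) / 2 ≤ v) : coverage v τ = 1 := by
  have : ∫ s in (-(1 / 2) : ℝ)..(1 / 2), clamp (v - s * τ + 1 / 2) =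
      ∫ s in (-(1 / 2) : ℝ)..(1 / 2), (1 : ℝ) := by
    refine intervalIntegral.integral_congr fun s hs => ?_
    rw [Set.uIcc_of_le (by norm_num), Set.mem_Icc] at hs
    exact clamp_of_one_le (by nlinarith)
  rw [coverage, this, intervalIntegral.integral_const]
  norm_num

end Spread

theorem spread_eq_zero {v τ : ℝ} (hτ : |τ| ≤ 1) (hv : 1 ≤ |v|) : spread v τ = 0 := by
  rw [← spread_abs_right]
  have h : ∀ w, 1 ≤ w → spread w |τ| = 0 := fun w hw => by
    rw [spread, coverage_outer (abs_nonneg _) (by linarith), sub_self, mul_zero]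
  rcases le_abs.1 hv with h1 | h1
  · exact h v h1
  · rw [← spread_neg_left]; exact h _ h1

/-- The integral of `spread` over all heights, for a line of slope `τ ∈ [0, 1]`. -/
noncomputable def spreadMean (τ : ℝ) : ℝ := 1 / 6 + τ ^ 2 / 12 - τ ^ 3 / 60

theorem integral_spread_zero_one {τ : ℝ} (h0 : 0 ≤ τ) (h1 : τ ≤ 1) :
    ∫ v in (0 : ℝ)..1, spread v τ = spreadMean τ / 2 := by
  have hi : ∀ a b, IntervalIntegrable (fun v => spread v τ) volume a b := fun a b =>
    (continuous_spread τ).intervalIntegrable a b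
  rw [← intervalIntegral.integral_add_adjacent_intervals (hi 0 ((1 + τ) / 2)) (hi _ 1),
    ← intervalIntegral.integral_add_adjacent_intervals (hi 0 ((1 - τ) / 2)) (hi _ ((1 + τ) / 2))]
  have e1 : ∫ v in (0 : ℝ)..((1 - τ) / 2), spread v τ =
      1 / 4 * ((1 - τ) / 2) - ((1 - τ) / 2) ^ 3 / 3 := by
    have : ∫ v in (0 : ℝ)..((1 - τ) / 2), spread v τ =
        ∫ v in (0 : ℝ)..((1 - τ) / 2), (1 / 4 - v ^ 2) := by
      refine intervalIntegral.integral_congr fun v hv => ?_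
      rw [Set.uIcc_of_le (by linarith), Set.mem_Icc] at hv
      rw [spread, coverage_inner h0 hv.1 hv.2]
      ring
    rw [this, intervalIntegral.integral_sub (by simp)
      (by apply Continuous.intervalIntegrable; fun_prop), intervalIntegral.integral_const,
      integral_pow, smul_eq_mul]
    norm_num
    ring
  have e2 : ∫ v in ((1 - τ) / 2)..((1 + τ) / 2), spread v τ = τ ^ 2 / 6 - τ ^ 3 / 20 := by
    -- The triangle formula divides by `τ`; for `τ = 0` the interval is a point.
    rcases h0.eq_or_lt with rfl | hpos
    · simp
    have : ∫ v in ((1 - τ) / 2)..((1 + τ) / 2), spread v τ =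
        ∫ v in ((1 - τ) / 2)..((1 + τ) / 2),
          (fun t : ℝ => t ^ 2 * (1 / (2 * τ)) - t ^ 4 * (1 / (4 * τ ^ 2))) ((1 + τ) / 2 - v) := by
      refine intervalIntegral.integral_congr fun v hv => ?_
      rw [Set.uIcc_of_le (by linarith), Set.mem_Icc] at hv
      simp only
      rw [spread, coverage_middle hpos h1 hv.1 hv.2]
      field_simp
      ring
    rw [this, intervalIntegral.integral_comp_sub_left
      (fun t : ℝ => t ^ 2 * (1 / (2 * τ)) - t ^ 4 * (1 / (4 * τ ^ 2))), intervalIntegral.integral_sub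
      (by apply Continuous.intervalIntegrable; fun_prop)
      (by apply Continuous.intervalIntegrable; fun_prop), intervalIntegral.integral_mul_const,
      intervalIntegral.integral_mul_const, integral_pow, integral_pow]
    have t : (1 + τ) / 2 - (1 - τ) / 2 = τ := by ring
    rw [t, sub_self]
    norm_num
    field_simp
    ring
  have e3 : ∫ v in ((1 + τ) / 2)..1, spread v τ = 0 := by
    have : ∫ v in ((1 + τ) / 2)..1, spread v τ = ∫ v in ((1 + τ) / 2)..1, (0 : ℝ) := by
      refine intervalIntegral.integral_congr fun v hv => ?_
      rw [Set.uIcc_of_le (by linarith), Set.mem_Icc] at hv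
      rw [spread, coverage_outer h0 hv.1, sub_self, mul_zero]
    rw [this]; simp
  rw [e1, e2, e3, spreadMean]
  ring

/-- The periodization of `spread`, on the unit interval. -/
noncomputable def spreadSum (τ u : ℝ) : ℝ := ∑ j ∈ Finset.range 7, spread (u + 3 - j) τ

/-- The seven translates unfold `[0, 1]` to `[-3, 4]`, which contains the support `[-1, 1]` of
`spread`; evenness doubles the integral over `[0, 1]`. -/
theorem integral_spreadSum {τ : ℝ} (hτ : |τ| ≤ 1) :
    ∫ u in (0 : ℝ)..1, spreadSum τ u = spreadMean |τ| := by
  have hc := continuous_spread |τ|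
  have hi : ∀ a b, IntervalIntegrable (fun v => spread v |τ|) volume a b := fun a b =>
    hc.intervalIntegrable a b
  have hz : ∀ a b : ℝ, a ≤ b → (1 ≤ a ∨ b ≤ -1) → ∫ v in a..b, spread v |τ| = 0 := by
    intro a b hab h
    have : ∫ v in a..b, spread v |τ| = ∫ v in a..b, (0 : ℝ) := by
      refine intervalIntegral.integral_congr fun v hv => ?_
      rw [Set.uIcc_of_le hab, Set.mem_Icc] at hv
      apply spread_eq_zero (by rwa [abs_abs])
      rw [le_abs]
      rcases h with h | h
      · left; linarith
      · right; linarith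
    rw [this]; simp
  have hneg : ∫ v in (-1 : ℝ)..0, spread v |τ| = ∫ v in (0 : ℝ)..1, spread v |τ| := by
    have := intervalIntegral.integral_comp_neg (a := (0 : ℝ)) (b := 1) (fun v => spread v |τ|)
    simp only [spread_neg_left, neg_zero] at this
    exact this.symm
  simp only [spreadSum]
  rw [intervalIntegral.integral_finsetSum]
  · have hj : ∀ j ∈ Finset.range 7, ∫ u in (0 : ℝ)..1, spread (u + 3 - j) τ =
        ∫ v in (3 - (j : ℝ))..(4 - j), spread v |τ| := by
      intro j _
      simp only [← spread_abs_right _ τ, add_sub_assoc]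
      rw [intervalIntegral.integral_comp_add_right (fun v => spread v |τ|)]
      congr 1 <;> ring
    rw [Finset.sum_congr rfl hj]
    simp only [Finset.sum_range_succ, Finset.sum_range_zero]
    norm_num
    rw [hz 3 4 (by norm_num) (by norm_num), hz 2 3 (by norm_num) (by norm_num),
      hz 1 2 (by norm_num) (by norm_num), hz (-2) (-1) (by norm_num) (by norm_num),
      hz (-3) (-2) (by norm_num) (by norm_num), hneg,
      integral_spread_zero_one (abs_nonneg _) hτ]
    ring
  · intro j _
    have := continuous_spread τ
    apply Continuous.intervalIntegrable; fun_prop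

theorem abs_spreadSum_sub_le (τ σ u v : ℝ) :
    |spreadSum τ u - spreadSum σ v| ≤ 7 * (|u - v| + |τ - σ|) := by
  rw [spreadSum, spreadSum, ← Finset.sum_sub_distrib]
  refine (Finset.abs_sum_le_sum_abs _ _).trans ?_
  refine (Finset.sum_le_sum fun j _ => abs_spread_sub_le _ _ _ _).trans (le_of_eq ?_)
  simp
  ring

theorem abs_spreadSum_le (τ u : ℝ) : |spreadSum τ u| ≤ 7 := by
  rw [spreadSum]
  refine (Finset.abs_sum_le_sum_abs _ _).trans ?_
  refine (Finset.sum_le_sum fun j _ => abs_spread_le_one _ _).trans (le_of_eq ?_)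
  simp

/-! ### The sum of `A(1 - A)` over the annulus -/

/-- The product of the covered and the uncovered area of the square at a lattice point. -/
noncomputable def areaSpread (R : ℝ) (l : ℤ × ℤ) : ℝ := area R l * (1 - area R l)

theorem abs_areaSpread_le (R : ℝ) (l : ℤ × ℤ) : |areaSpread R l| ≤ 1 := by
  have h0 := area_nonneg R l
  have h1 := area_le_one R l
  rw [areaSpread, abs_le]; constructor <;> nlinarith

theorem areaSpread_rotate {R : ℝ} (hR : 0 < R) (m n : ℤ) :
    areaSpread R (-n, m) = areaSpread R (m, n) := by
  rw [areaSpread, areaSpread, area_rotate hR]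

theorem mem_annulus_of_areaSpread_ne_zero {R : ℝ} {l : ℤ × ℤ}
    (h : areaSpread R l ≠ 0) : latticePoint l ∈ annulus R := by
  by_contra hn
  apply h
  rw [annulus, Set.mem_ofPred_eq, not_and_or, not_lt, not_lt] at hn
  rw [areaSpread]
  rcases hn with hn | hn
  · rw [area_eq_one hn]; simp
  · rw [area_eq_zero hn]; simp

theorem sum_areaSpread_Gam {R : ℝ} {B : ℤ} (hB : R + 1 ≤ B) :
    ∑ l ∈ Gam R, areaSpread R l = ∑ l ∈ box B, areaSpread R l := by
  apply Finset.sum_subset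
  · rw [Gam_eq_filter hB]; exact Finset.filter_subset _ _
  · intro l _ hl
    by_contra h
    exact hl (mem_Gam.2 (mem_annulus_of_areaSpread_ne_zero h))

theorem div_hgt_le_div_hgt {R x y : ℝ} (hxy : x ≤ y) (hx : x ^ 2 < R ^ 2) (hy : y ^ 2 < R ^ 2) :
    x / hgt R x ≤ y / hgt R y := by
  have hx0 : 0 < hgt R x := Real.sqrt_pos.2 (by linarith)
  have hy0 : 0 < hgt R y := Real.sqrt_pos.2 (by linarith)
  rcases le_total 0 x with h0 | h0
  · apply div_le_div₀ (h0.trans hxy) hxy hy0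
    apply Real.sqrt_le_sqrt
    nlinarith
  · rcases le_total 0 y with h1 | h1
    · exact (div_nonpos_of_nonpos_of_nonneg h0 hx0.le).trans (div_nonneg h1 hy0.le)
    · have : -y / hgt R y ≤ -x / hgt R x := by
        apply div_le_div₀ (by linarith) (by linarith) hx0
        apply Real.sqrt_le_sqrt
        nlinarith
      rw [neg_div, neg_div] at this
      linarith

section Columns

variable {R : ℝ} {M : ℕ}

/-- Truncation is 1-Lipschitz, so replacing the arc by its tangent costs no more than the Taylor
error. -/
theorem abs_area_sub_coverage_le (hR : 100 ≤ R) (hM : 2 * ((M : ℝ) + 10) ^ 2 ≤ R ^ 2) {m n : ℤ}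
    (hm : |m| ≤ M) (hn : 1 ≤ n) :
    |area R (m, n) - coverage (hgt R m - n) (m / hgt R m)| ≤ 6 / R := by
  have h2 := two_mul_intCast_sq_le hM hm
  have hc := continuous_hgt R
  have hcc := continuous_clamp
  rw [area_eq_integral (by linarith) m hn, coverage, ← intervalIntegral.integral_sub
    (by apply Continuous.intervalIntegrable; fun_prop) (intervalIntegrable_clamp _ _ _ _)]
  have := intervalIntegral.norm_integral_le_of_norm_le_const (a := (-(1 / 2) : ℝ)) (b := 1 / 2)
    (C := 6 / R) (f := fun s => clamp (hgt R (m + s) - n + 1 / 2) -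
      clamp (hgt R m - n - s * (m / hgt R m) + 1 / 2)) (by
      intro s hs
      rw [Set.uIoc_of_le (by norm_num)] at hs
      refine (abs_clamp_sub_le _ _).trans ?_
      convert! abs_hgt_taylor_le (s := s) (by linarith) h2
        (abs_le.2 ⟨by linarith [hs.1], by linarith [hs.2]⟩) using 2
      ring)
  rw [Real.norm_eq_abs] at this
  refine this.trans (le_of_eq ?_)
  norm_num

theorem abs_columnSum_areaSpread_sub_le (hR : 100 ≤ R) (hM : 2 * ((M : ℝ) + 10) ^ 2 ≤ R ^ 2)
    {m : ℤ} (hm : |m| ≤ M) :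
    |columnSum R (areaSpread R) m - spreadSum (m / hgt R m) (Int.fract (hgt R m))| ≤ 42 / R := by
  have hk := four_le_floor_hgt hM hm
  rw [columnSum, spreadSum, ← Finset.sum_sub_distrib]
  refine (Finset.abs_sum_le_sum_abs _ _).trans ?_
  refine (Finset.sum_le_sum fun j _ => ?_).trans (b := ∑ j ∈ Finset.range 7, 6 / R) ?_
  · rw [areaSpread, spread]
    refine (abs_mul_one_sub_sub_le (area_nonneg _ _) (area_le_one _ _) (coverage_nonneg _ _)
      (coverage_le_one _ _)).trans ?_
    have := abs_area_sub_coverage_le hR hM hm (n := ⌊hgt R m⌋ - 3 + (j : ℤ)) (by omega)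
    convert! this using 3
    rw [Int.fract]
    push_cast
    congr 1
    ring
  · rw [Finset.sum_const, Finset.card_range, nsmul_eq_mul]
    apply le_of_eq; push_cast; ring

/-- The slopes increase from at least `-1` to at most `1`, so their variation telescopes. -/
theorem sum_abs_slope_sub_le (hR : 100 ≤ R) (hM : 2 * ((M : ℝ) + 10) ^ 2 ≤ R ^ 2) :
    ∑ i ∈ Finset.range (2 * M), |(((i + 1 : ℕ) : ℝ) - M) / hgt R (((i + 1 : ℕ) : ℝ) - M) -
      ((i : ℝ) - M) / hgt R ((i : ℝ) - M)| ≤ 2 := by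
  have hM2 := two_mul_natCast_sq_le hM
  have hb : ∀ i : ℕ, i ≤ 2 * M → 2 * ((i : ℝ) - M) ^ 2 ≤ R ^ 2 := fun i hi =>
    two_mul_natCast_sub_sq_le hM2 hi
  have hR2 : 0 < R ^ 2 := by positivity
  have : ∀ i ∈ Finset.range (2 * M), |(((i + 1 : ℕ) : ℝ) - M) / hgt R (((i + 1 : ℕ) : ℝ) - M) -
      ((i : ℝ) - M) / hgt R ((i : ℝ) - M)| =
      (((i + 1 : ℕ) : ℝ) - M) / hgt R (((i + 1 : ℕ) : ℝ) - M) -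
      ((i : ℝ) - M) / hgt R ((i : ℝ) - M) := by
    intro i hi
    rw [Finset.mem_range] at hi
    apply abs_of_nonneg
    rw [sub_nonneg]
    apply div_hgt_le_div_hgt
    · push_cast; linarith
    · linarith [hb i (by omega), sq_nonneg ((i : ℝ) - M)]
    · linarith [hb (i + 1) (by omega), sq_nonneg (((i + 1 : ℕ) : ℝ) - M)]
  rw [Finset.sum_congr rfl this,
    Finset.sum_range_sub (fun i : ℕ => ((i : ℝ) - M) / hgt R ((i : ℝ) - M))]
  have h1 := abs_le.1 (abs_div_hgt_le (R := R) (by linarith) (hb (2 * M) le_rfl))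
  have h2 := abs_le.1 (abs_div_hgt_le (R := R) (by linarith) (hb 0 (by omega)))
  linarith [h1.2, h2.1]

theorem abs_sum_columnSum_areaSpread_sub_le (hR : 100 ≤ R)
    (hM : 2 * ((M : ℝ) + 10) ^ 2 ≤ R ^ 2) {J : ℕ} (hJ : 0 < J) :
    |∑ i ∈ Finset.range (2 * M + 1), columnSum R (areaSpread R) (i - M) -
      ∑ i ∈ Finset.range (2 * M + 1), (spreadMean |((i : ℝ) - M) / hgt R ((i : ℝ) - M)|)| ≤
      70 + 23 * (R / J) + 12684 * (J * R ^ (2 / 3 : ℝ)) := by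
  have hJ' : (0 : ℝ) < J := by exact_mod_cast hJ
  have hM2 := two_mul_natCast_sq_le hM
  have hN := natCast_two_mul_add_one_le (by linarith) hM2
  -- Each of the seven summands of `spreadSum` is bounded by one and 1-Lipschitz in height and
  -- slope; with total slope variation `2` this gives `b = 7`, `L = 7`, `v = 14`.
  have h1 := abs_sum_fract_sub_sum_integral_le (x := fun i : ℕ => hgt R ((i : ℝ) - M))
    (n := 2 * M) (d := 302 * R ^ (2 / 3 : ℝ)) (b := 7) (v := 14) (L := 7)
    (g := fun i => spreadSum (((i : ℝ) - M) / hgt R ((i : ℝ) - M)))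
    (fun k hk c => abs_sum_saw_hgt_le (by linarith) hM2 hk c)
    (fun i u v => by
      have := abs_spreadSum_sub_le (((i : ℝ) - M) / hgt R ((i : ℝ) - M))
        (((i : ℝ) - M) / hgt R ((i : ℝ) - M)) u v
      rwa [sub_self (_ / _), abs_zero, add_zero] at this)
    (fun i u => abs_spreadSum_le _ u)
    (fun u => by
      refine (Finset.sum_le_sum fun i _ => abs_spreadSum_sub_le _ _ u u).trans ?_
      simp only [sub_self, abs_zero, zero_add]
      rw [← Finset.mul_sum]
      linarith [sum_abs_slope_sub_le hR hM]) hJ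
  have h2 : |∑ i ∈ Finset.range (2 * M + 1), (columnSum R (areaSpread R) (i - M) -
      spreadSum (((i : ℝ) - M) / hgt R ((i : ℝ) - M)) (Int.fract (hgt R ((i : ℝ) - M))))| ≤ 70 := by
    refine (Finset.abs_sum_le_sum_abs _ _).trans ?_
    refine (Finset.sum_le_sum fun i hi => ?_).trans (b := ∑ i ∈ Finset.range (2 * M + 1), 42 / R) ?_
    · have := abs_columnSum_areaSpread_sub_le hR hM (natCast_sub_abs_le hi)
      push_cast at this
      exact this
    · rw [Finset.sum_const, nsmul_eq_mul, Finset.card_range]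
      push_cast
      rw [mul_div_assoc', div_le_iff₀ (by linarith)]
      linarith
  have h3 : ∑ i ∈ Finset.range (2 * M + 1), ∫ u in (0 : ℝ)..1,
      spreadSum (((i : ℝ) - M) / hgt R ((i : ℝ) - M)) u =
      ∑ i ∈ Finset.range (2 * M + 1), spreadMean |((i : ℝ) - M) / hgt R ((i : ℝ) - M)| := by
    refine Finset.sum_congr rfl fun i hi => integral_spreadSum ?_
    rw [Finset.mem_range] at hi
    exact abs_div_hgt_le (by linarith) (two_mul_natCast_sub_sq_le hM2 (by omega))
  have h4 : 2 * (((2 * M : ℕ) : ℝ) + 1) * 7 / J ≤ 23 * (R / J) := by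
    rw [mul_div_assoc']
    refine div_le_div_of_nonneg_right ?_ hJ'.le
    push_cast
    linarith
  rw [h3] at h1
  rw [Finset.sum_sub_distrib] at h2
  have h5 : 2 * (J : ℝ) * ((7 + 14) * (302 * R ^ (2 / 3 : ℝ))) = 12684 * (J * R ^ (2 / 3 : ℝ)) := by
    ring
  rw [h5] at h1
  rw [abs_le] at *
  constructor <;> linarith [h1.1, h1.2, h2.1, h2.2]

end Columns

/-- With `R^(1/6)` bins the discretization error `R / J` and the equidistribution error `J *
R^(2/3)` are both of order `R^(5/6)`. -/
theorem exists_natCast_between {R : ℝ} (hR : 1 ≤ R) :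
    ∃ J : ℕ, 0 < J ∧ R ^ (1 / 6 : ℝ) ≤ J ∧ (J : ℝ) ≤ 2 * R ^ (1 / 6 : ℝ) := by
  have h1 : 1 ≤ R ^ (1 / 6 : ℝ) := Real.one_le_rpow hR (by norm_num)
  refine ⟨⌈R ^ (1 / 6 : ℝ)⌉₊, Nat.ceil_pos.2 (by linarith), Nat.le_ceil _, ?_⟩
  linarith [Nat.ceil_lt_add_one (show 0 ≤ R ^ (1 / 6 : ℝ) by linarith)]

theorem abs_sum_areaSpread_sub_le {R : ℝ} {M : ℕ} (hR : 100 ≤ R)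
    (hM : 2 * ((M : ℝ) + 10) ^ 2 ≤ R ^ 2) (hM' : R ^ 2 < 2 * ((M : ℝ) + 11) ^ 2) :
    |∑ l ∈ Gam R, areaSpread R l - 4 * ∑ i ∈ Finset.range (2 * M + 1),
      (spreadMean |((i : ℝ) - M) / hgt R ((i : ℝ) - M)|)| ≤ 110000 * R ^ (5 / 6 : ℝ) := by
  have hR0 : 0 < R := by linarith
  obtain ⟨B, hB⟩ := exists_int_gt (R + 10)
  obtain ⟨J, hJ, hJ1, hJ2⟩ := exists_natCast_between (R := R) (by linarith)
  have h1 := abs_sum_box_sub_columns_le (T := areaSpread R) hR hM hM' (B := B) (by linarith)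
    (areaSpread_rotate (by linarith)) (abs_areaSpread_le R) (fun m n h =>
      sq_bounds_of_mem_annulus (by linarith) (mem_annulus_of_areaSpread_ne_zero h))
  have h2 := abs_sum_columnSum_areaSpread_sub_le hR hM hJ
  rw [← sum_areaSpread_Gam (by linarith)] at h1
  have hJ' : (0 : ℝ) < J := by exact_mod_cast hJ
  have e1 : R ^ (1 / 6 : ℝ) * R ^ (5 / 6 : ℝ) = R := by
    rw [← Real.rpow_add hR0]; norm_num
  have e2 : R ^ (1 / 6 : ℝ) * R ^ (2 / 3 : ℝ) = R ^ (5 / 6 : ℝ) := by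
    rw [← Real.rpow_add hR0]; norm_num
  have h56 : 0 < R ^ (5 / 6 : ℝ) := by positivity
  have h3 : R / J ≤ R ^ (5 / 6 : ℝ) := by
    rw [div_le_iff₀ hJ']
    nlinarith
  have h4 : J * R ^ (2 / 3 : ℝ) ≤ 2 * R ^ (5 / 6 : ℝ) := by
    rw [← e2, ← mul_assoc]
    gcongr
  have h5 : 1 ≤ R ^ (5 / 6 : ℝ) := Real.one_le_rpow (by linarith) (by norm_num)
  rw [abs_le] at *
  constructor <;> linarith [h1.1, h1.2, h2.1, h2.2]

/-! ### The Riemann sum and the limiting constant -/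

theorem sum_range_even (f : ℝ → ℝ) (hf : ∀ x, f (-x) = f x) (M : ℕ) :
    ∑ i ∈ Finset.range (2 * M + 1), f ((i : ℝ) - M) =
      f 0 + 2 * ∑ k ∈ Finset.range M, f ((k : ℝ) + 1) := by
  induction M with
  | zero => simp
  | succ M ih =>
    rw [show 2 * (M + 1) + 1 = (2 * M + 1) + 1 + 1 by ring, Finset.sum_range_succ,
      Finset.sum_range_succ', Finset.sum_range_succ _ M]
    have e : ∀ i ∈ Finset.range (2 * M + 1), f (((i + 1 : ℕ) : ℝ) - ((M + 1 : ℕ) : ℝ)) =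
        f ((i : ℝ) - M) := by
      intro i _
      congr 1
      push_cast
      ring
    rw [Finset.sum_congr rfl e, ih]
    have e1 : ((0 : ℕ) : ℝ) - ((M + 1 : ℕ) : ℝ) = -((M : ℝ) + 1) := by push_cast; ring
    have e2 : ((2 * M + 1 + 1 : ℕ) : ℝ) - ((M + 1 : ℕ) : ℝ) = (M : ℝ) + 1 := by push_cast; ring
    rw [e1, e2, hf]
    ring

/-- The local variance density as a function of the abscissa on the unit circle. -/
noncomputable def spreadDensity (x : ℝ) : ℝ := spreadMean (x / √(1 - x ^ 2))

/-- An antiderivative of `spreadDensity`. -/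
noncomputable def spreadPrimitive (x : ℝ) : ℝ :=
  x / 12 + (Real.log (1 + x) - Real.log (1 - x)) / 24 -
    (1 / √(1 - x ^ 2) + √(1 - x ^ 2)) / 60 + 1 / 30

/-- With `c = √(1 - x²)`, the powers of the slope `x / c` are `x²/c² = 1/c² - 1` and `x³/c³ = x/c³ -
x/c`. These are the derivatives of the logarithmic part minus `x`, and of `1/c + c`. -/
theorem hasDerivAt_spreadPrimitive {x : ℝ} (h0 : 0 ≤ x) (h1 : x < 1) :
    HasDerivAt spreadPrimitive (spreadDensity x) x := by
  have hpos : 0 < 1 - x ^ 2 := by nlinarith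
  have hc0 : 0 < √(1 - x ^ 2) := Real.sqrt_pos.2 hpos
  have hcc : √(1 - x ^ 2) ^ 2 = 1 - x ^ 2 := Real.sq_sqrt hpos.le
  have d0 : HasDerivAt (fun x : ℝ => √(1 - x ^ 2)) (-x / √(1 - x ^ 2)) x := by
    have := (((hasDerivAt_id x).pow 2).const_sub 1).sqrt (by simpa using hpos.ne')
    convert! this using 1
    simp
    field_simp
  have d1 : HasDerivAt (fun x : ℝ => 1 / √(1 - x ^ 2)) (x / √(1 - x ^ 2) ^ 3) x := by
    have := d0.fun_inv hc0.ne'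
    simp only [one_div]
    convert! this using 1
    field_simp
  have d2 : HasDerivAt (fun x : ℝ => Real.log (1 + x)) (1 / (1 + x)) x :=
    ((hasDerivAt_id x).const_add 1).log (by simp only [id]; linarith)
  have d3 : HasDerivAt (fun x : ℝ => Real.log (1 - x)) (-1 / (1 - x)) x :=
    ((hasDerivAt_id x).const_sub 1).log (by simp only [id]; linarith)
  have d := ((((hasDerivAt_id x).div_const 12).add ((d2.sub d3).div_const 24)).sub
    ((d1.add d0).div_const 60)).add_const (1 / 30 : ℝ)
  convert! d using 1
  rw [spreadDensity, spreadMean]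
  have e1 : (1 / (1 + x) - -1 / (1 - x)) = 2 / √(1 - x ^ 2) ^ 2 := by
    rw [hcc]
    have : 1 + x ≠ 0 := by linarith
    have : 1 - x ≠ 0 := by linarith
    have : 1 - x ^ 2 ≠ 0 := hpos.ne'
    field_simp
    ring
  rw [e1]
  set c := √(1 - x ^ 2)
  have hx : x ^ 2 = 1 - c ^ 2 := by linarith
  field_simp
  have hx3 : x ^ 3 = x * (1 - c ^ 2) := by rw [← hx]; ring
  rw [hx3, hx]
  ring

theorem spreadMean_mono {s t : ℝ} (hs : 0 ≤ s) (hst : s ≤ t) (ht : t ≤ 1) :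
    spreadMean s ≤ spreadMean t := by
  have : spreadMean t - spreadMean s = (t - s) * (5 * (t + s) - (t ^ 2 + t * s + s ^ 2)) / 60 := by
    rw [spreadMean, spreadMean]; ring
  have h2 : 0 ≤ (t - s) * (5 * (t + s) - (t ^ 2 + t * s + s ^ 2)) / 60 := by
    apply div_nonneg _ (by norm_num)
    apply mul_nonneg (by linarith)
    nlinarith
  linarith

theorem div_sqrt_eq_div_hgt {R : ℝ} (hR : 0 < R) (x : ℝ) :
    x / R / √(1 - (x / R) ^ 2) = x / hgt R x := by
  have : √(1 - (x / R) ^ 2) = hgt R x / R := by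
    rw [hgt, show 1 - (x / R) ^ 2 = (R ^ 2 - x ^ 2) / R ^ 2 by field_simp,
      Real.sqrt_div' _ (by positivity), Real.sqrt_sq hR.le]
  rw [this]
  field_simp

theorem spreadDensity_div {R : ℝ} (hR : 0 < R) (x : ℝ) :
    spreadDensity (x / R) = spreadMean (x / hgt R x) := by
  rw [spreadDensity, div_sqrt_eq_div_hgt hR]

theorem spreadDensity_mono {x y : ℝ} (hx : 0 ≤ x) (hxy : x ≤ y) (hy : 2 * y ^ 2 ≤ 1) :
    spreadDensity x ≤ spreadDensity y := by
  have h := div_hgt_le_div_hgt (R := 1) hxy (by nlinarith) (by nlinarith)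
  have h1 := abs_div_hgt_le (R := 1) (x := y) one_pos (by linarith)
  simp only [hgt, one_pow] at h h1
  exact spreadMean_mono (div_nonneg hx (Real.sqrt_nonneg _)) h ((le_abs_self _).trans h1)

theorem spreadPrimitive_zero : spreadPrimitive 0 = 0 := by
  simp [spreadPrimitive]; norm_num

theorem spreadPrimitive_slope {x y : ℝ} (hx : 0 ≤ x) (hxy : x < y) (hy : 2 * y ^ 2 ≤ 1) :
    spreadDensity x * (y - x) ≤ spreadPrimitive y - spreadPrimitive x ∧
      spreadPrimitive y - spreadPrimitive x ≤ spreadDensity y * (y - x) := by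
  have hy1 : y < 1 := by nlinarith
  have hd : ∀ z ∈ Set.Icc x y, HasDerivAt spreadPrimitive (spreadDensity z) z := fun z hz =>
    hasDerivAt_spreadPrimitive (hx.trans hz.1) (hz.2.trans_lt hy1)
  obtain ⟨c, hc, e⟩ := exists_hasDerivAt_eq_slope spreadPrimitive spreadDensity hxy
    (fun z hz => (hd z hz).continuousAt.continuousWithinAt)
    (fun z hz => hd z (Set.Ioo_subset_Icc_self hz))
  have hpos : 0 < y - x := by linarith
  rw [eq_div_iff hpos.ne'] at e
  rw [← e]
  have hc2 : 2 * c ^ 2 ≤ 1 := by nlinarith [hc.1, hc.2]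
  constructor
  · exact mul_le_mul_of_nonneg_right (spreadDensity_mono hx hc.1.le hc2) hpos.le
  · exact mul_le_mul_of_nonneg_right
      (spreadDensity_mono (hx.trans hc.1.le) hc.2.le hy) hpos.le

/-- The density increases on this range, so the left and right Riemann sums enclose the increment of
the primitive and differ by at most `1/3 - 1/6`; the central column adds `1/6`. -/
theorem abs_sum_spreadMean_sub_le {R : ℝ} {M : ℕ} (hR : 0 < R) (hM : 2 * (M : ℝ) ^ 2 ≤ R ^ 2) :
    |∑ i ∈ Finset.range (2 * M + 1), spreadMean |((i : ℝ) - M) / hgt R ((i : ℝ) - M)| -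
      2 * (R * spreadPrimitive (M / R))| ≤ 1 := by
  rw [sum_range_even (fun x => spreadMean |x / hgt R x|) (fun x => by
    rw [hgt_neg, neg_div, abs_neg])]
  have h0 : spreadMean |(0 : ℝ) / hgt R 0| = 1 / 6 := by simp [spreadMean]
  rw [h0]
  have e : ∀ k ∈ Finset.range M, spreadMean |((k : ℝ) + 1) / hgt R ((k : ℝ) + 1)| =
      spreadDensity (((k + 1 : ℕ) : ℝ) / R) := by
    intro k _
    rw [spreadDensity_div hR, abs_of_nonneg (div_nonneg (by positivity) (hgt_nonneg _ _))]
    push_cast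
    rfl
  rw [Finset.sum_congr rfl e]
  have hb : ∀ k : ℕ, k ≤ M → 2 * ((k : ℝ) / R) ^ 2 ≤ 1 := by
    intro k hk
    rw [div_pow, mul_div_assoc', div_le_one (by positivity)]
    refine le_trans ?_ hM
    have : (k : ℝ) ≤ M := by exact_mod_cast hk
    gcongr
  have hs : ∀ k ∈ Finset.range M, spreadDensity ((k : ℝ) / R) ≤
      R * (spreadPrimitive (((k + 1 : ℕ) : ℝ) / R) - spreadPrimitive ((k : ℝ) / R)) ∧
      R * (spreadPrimitive (((k + 1 : ℕ) : ℝ) / R) - spreadPrimitive ((k : ℝ) / R)) ≤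
      spreadDensity (((k + 1 : ℕ) : ℝ) / R) := by
    intro k hk
    rw [Finset.mem_range] at hk
    have hlt : (k : ℝ) / R < ((k + 1 : ℕ) : ℝ) / R := by gcongr; simp
    obtain ⟨s1, s2⟩ := spreadPrimitive_slope (by positivity) hlt (hb (k + 1) hk)
    have hd : ((k + 1 : ℕ) : ℝ) / R - (k : ℝ) / R = 1 / R := by push_cast; ring
    rw [hd, mul_one_div] at s1 s2
    rw [div_le_iff₀' hR] at s1
    rw [le_div_iff₀' hR] at s2
    exact ⟨s1, s2⟩
  have htel : ∑ k ∈ Finset.range M,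
      R * (spreadPrimitive (((k + 1 : ℕ) : ℝ) / R) - spreadPrimitive ((k : ℝ) / R)) =
      R * spreadPrimitive (M / R) := by
    rw [← Finset.mul_sum, Finset.sum_range_sub (fun k : ℕ => spreadPrimitive ((k : ℝ) / R))]
    simp [spreadPrimitive_zero]
  have l1 := Finset.sum_le_sum fun k hk => (hs k hk).1
  have l2 := Finset.sum_le_sum fun k hk => (hs k hk).2
  rw [htel] at l1 l2
  have l3 := Finset.sum_range_sub (fun k : ℕ => spreadDensity ((k : ℝ) / R)) M
  rw [Finset.sum_sub_distrib] at l3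
  have l4 : spreadDensity ((M : ℝ) / R) ≤ 1 / 3 := by
    rw [spreadDensity_div hR]
    have h1 := abs_div_hgt_le hR hM
    have h2 : 0 ≤ (M : ℝ) / hgt R M := div_nonneg (by positivity) (hgt_nonneg _ _)
    rw [abs_of_nonneg h2] at h1
    refine (spreadMean_mono h2 h1 le_rfl).trans ?_
    rw [spreadMean]; norm_num
  have l5 : spreadDensity (((0 : ℕ) : ℝ) / R) = 1 / 6 := by simp [spreadDensity, spreadMean]
  rw [abs_le]
  constructor <;> linarith

/-- The factor `8` comes from four quarter turns and two signs of `m`; the cut-off `M / R` tends to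
`1/√2`, the abscissa of the diagonal. -/
theorem tendsto_sum_areaSpread_div :
    Tendsto (fun R => (∑ l ∈ Gam R, areaSpread R l) / R) atTop
      (𝓝 (8 * spreadPrimitive (1 / √2))) := by
  -- The condition on `R` sits inside the existential so that `M` can be chosen as a function of
  -- every real `R`.
  have hex : ∀ R : ℝ, ∃ M : ℕ, 100 ≤ R →
      2 * ((M : ℝ) + 10) ^ 2 ≤ R ^ 2 ∧ R ^ 2 < 2 * ((M : ℝ) + 11) ^ 2 := by
    intro R
    by_cases h : 100 ≤ R
    · obtain ⟨M, hM⟩ := exists_column_bound h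
      exact ⟨M, fun _ => hM⟩
    · exact ⟨0, fun h' => absurd h' h⟩
  choose M hM using hex
  have hs2 : √(2 : ℝ) ^ 2 = 2 := Real.sq_sqrt (by norm_num)
  have hs0 : 0 < √(2 : ℝ) := by positivity
  have hinv : Tendsto (fun R : ℝ => 11 * R⁻¹) atTop (𝓝 0) := by
    simpa using tendsto_inv_atTop_zero.const_mul (11 : ℝ)
  have hMR : Tendsto (fun R => (M R : ℝ) / R) atTop (𝓝 (1 / √2)) := by
    have hlo : Tendsto (fun R : ℝ => 1 / √2 - 11 * R⁻¹) atTop (𝓝 (1 / √2)) := by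
      simpa using tendsto_const_nhds.sub hinv
    refine tendsto_of_tendsto_of_tendsto_of_le_of_le' hlo tendsto_const_nhds ?_ ?_
    · filter_upwards [eventually_ge_atTop 100] with R hR
      obtain ⟨_, h2⟩ := hM R hR
      have : R < √2 * (M R + 11) := by
        apply lt_of_pow_lt_pow_left₀ 2 (by positivity)
        rw [mul_pow, hs2]; exact h2
      have hR0 : 0 < R := by linarith
      rw [sub_le_iff_le_add, ← div_eq_mul_inv, ← add_div, div_le_div_iff₀ hs0 hR0]
      linarith
    · filter_upwards [eventually_ge_atTop 100] with R hR
      obtain ⟨h1, _⟩ := hM R hR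
      have hR0 : 0 < R := by linarith
      have : √2 * (M R + 10) ≤ R := by
        apply le_of_sq_le_sq _ hR0.le
        rw [mul_pow, hs2]; exact h1
      rw [div_le_div_iff₀ hR0 hs0]
      linarith
  have hlt : 1 / √(2 : ℝ) < 1 := one_div_sqrt_two_lt_one
  have hcont : ContinuousAt spreadPrimitive (1 / √2) :=
    (hasDerivAt_spreadPrimitive (by positivity) hlt).continuousAt
  have hmain : Tendsto (fun R => 8 * spreadPrimitive ((M R : ℝ) / R)) atTop
      (𝓝 (8 * spreadPrimitive (1 / √2))) := (hcont.tendsto.comp hMR).const_mul 8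
  have herr : Tendsto (fun R => (∑ l ∈ Gam R, areaSpread R l) / R -
      8 * spreadPrimitive ((M R : ℝ) / R)) atTop (𝓝 0) := by
    have hb : Tendsto (fun R : ℝ => 110004 * R ^ (-(1 / 6) : ℝ)) atTop (𝓝 0) := by
      simpa using (tendsto_rpow_neg_atTop (show (0 : ℝ) < 1 / 6 by norm_num)).const_mul 110004
    refine squeeze_zero_norm' ?_ hb
    filter_upwards [eventually_ge_atTop 100] with R hR
    obtain ⟨h1, h2⟩ := hM R hR
    have hR0 : 0 < R := by linarith
    have a1 := abs_sum_areaSpread_sub_le hR h1 h2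
    have a2 := abs_sum_spreadMean_sub_le hR0 (two_mul_natCast_sq_le h1)
    have e : (∑ l ∈ Gam R, areaSpread R l) / R - 8 * spreadPrimitive ((M R : ℝ) / R) =
        (∑ l ∈ Gam R, areaSpread R l - 8 * (R * spreadPrimitive ((M R : ℝ) / R))) / R := by
      field_simp
    rw [e, Real.norm_eq_abs, abs_div, abs_of_pos hR0, div_le_iff₀ hR0]
    have e2 : R ^ (-(1 / 6) : ℝ) * R = R ^ (5 / 6 : ℝ) := by
      nth_rewrite 2 [← Real.rpow_one R]
      rw [← Real.rpow_add hR0]; norm_num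
    rw [mul_assoc, e2]
    have h5 : 1 ≤ R ^ (5 / 6 : ℝ) := Real.one_le_rpow (by linarith) (by norm_num)
    rw [abs_le] at *
    constructor <;> linarith
  simpa using herr.add hmain

theorem spreadPrimitive_one_div_sqrt_two :
    8 * spreadPrimitive (1 / √2) = 4 / 15 + 2 * Real.log (1 + √2) / 3 + 2 * √2 / 15 := by
  have hs2 : √(2 : ℝ) ^ 2 = 2 := Real.sq_sqrt (by norm_num)
  have hs0 : 0 < √(2 : ℝ) := by positivity
  have hlt : 1 / √(2 : ℝ) < 1 := one_div_sqrt_two_lt_one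
  have hq : 1 / √(2 : ℝ) = √2 / 2 := by rw [div_eq_div_iff hs0.ne' two_ne_zero]; linarith
  have hsq : √(1 - (1 / √(2 : ℝ)) ^ 2) = 1 / √2 := by
    rw [div_pow, hs2, one_pow, show (1 : ℝ) - 1 / 2 = 1 / 2 by norm_num, Real.sqrt_div zero_le_one,
      Real.sqrt_one]
  have hlog : Real.log (1 + 1 / √2) - Real.log (1 - 1 / √2) = 2 * Real.log (1 + √2) := by
    rw [← Real.log_div (by positivity) (by linarith), ← Real.log_rpow (by positivity)]
    congr 1
    rw [hq, Real.rpow_two, div_eq_iff (by rw [hq] at hlt; linarith)]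
    nlinarith
  rw [spreadPrimitive, hlog, hsq, one_div_one_div, hq]
  ring

/-- Pointwise `(A - E)² = (1 - 2E)A + E² - A(1 - A)`. This trades the square for a function that
vanishes off the annulus and can be summed by columns. -/
theorem variance_eq {R : ℝ} (hK : K R ≠ 0) :
    variance R = mean R - mean R ^ 2 - (∑ l ∈ Gam R, areaSpread R l) / K R := by
  have hK' : (K R : ℝ) ≠ 0 := by exact_mod_cast hK
  have hs : ∑ l ∈ Gam R, area R l = K R * mean R := by rw [mean]; field_simp
  have e : ∀ l ∈ Gam R, (area R l - mean R) ^ 2 =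
      (1 - 2 * mean R) * area R l + mean R ^ 2 - areaSpread R l := by
    intro l _
    rw [areaSpread]; ring
  rw [variance, Finset.sum_congr rfl e, Finset.sum_sub_distrib, Finset.sum_add_distrib,
    ← Finset.mul_sum, hs, Finset.sum_const, nsmul_eq_mul]
  change 1 / (K R : ℝ) * (_ + (K R : ℝ) * _ - _) = _
  field_simp
  ring

theorem tendsto_variance : Tendsto variance atTop (𝓝 c₀) := by
  have hpi := Real.pi_pos
  have hs0 : 0 < √(2 : ℝ) := by positivity
  have hKpos : ∀ᶠ R in atTop, 0 < (K R : ℝ) / R :=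
    tendsto_K_div.eventually_const_lt (by positivity)
  have h := (tendsto_mean.sub (tendsto_mean.pow 2)).sub
    (tendsto_sum_areaSpread_div.div tendsto_K_div (by positivity))
  have hc : (1 / 2 : ℝ) - (1 / 2) ^ 2 - 8 * spreadPrimitive (1 / √2) / (2 * √2 * Real.pi) = c₀ := by
    rw [spreadPrimitive_one_div_sqrt_two, c₀]
    field_simp
    ring
  rw [hc] at h
  refine h.congr' ?_
  filter_upwards [hKpos, eventually_gt_atTop 0] with R h1 hR
  have hK : (K R : ℝ) ≠ 0 := by
    intro h0
    rw [h0, zero_div] at h1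
    exact lt_irrefl _ h1
  rw [variance_eq (by exact_mod_cast hK), Pi.div_apply, div_div_div_cancel_right₀ hR.ne']

/-! ### The numerical value of the limit -/

theorem sqrt_two_bounds : 1.41421356237 < √(2 : ℝ) ∧ √(2 : ℝ) < 1.41421356238 := by
  constructor
  · apply Real.lt_sqrt_of_sq_lt; norm_num
  · rw [Real.sqrt_lt' (by norm_num)]; norm_num

theorem log_one_add_sqrt_two_bounds :
    0.881373585 < Real.log (1 + √2) ∧ Real.log (1 + √2) < 0.881373589 := by
  obtain ⟨h1, h2⟩ := sqrt_two_bounds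
  have l1 := Real.log_two_gt_d9
  have l2 := Real.log_two_lt_d9
  constructor
  -- The argument is `(y - 1)/(y + 1)` for a decimal lower bound `y` of `(1 + √2)/2`; five terms of
  -- the inverse hyperbolic tangent series bound `log y`, and `log 2` is added.
  · have h := Real.sum_range_le_log_div (x := 20710678118 / 220710678118) (by norm_num)
      (by norm_num) 5
    norm_num [Finset.sum_range_succ] at h
    have e : Real.log (2 * (120710678118 / 100000000000)) ≤ Real.log (1 + √2) :=
      Real.log_le_log (by norm_num) (by linarith)
    rw [Real.log_mul (by norm_num) (by norm_num)] at e
    norm_num at e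
    linarith
  · have h := Real.log_div_le_sum_range_add (x := 20710678119 / 220710678119) (by norm_num)
      (by norm_num) 5
    norm_num [Finset.sum_range_succ] at h
    have e : Real.log (1 + √2) ≤ Real.log (2 * (120710678119 / 100000000000)) :=
      Real.log_le_log (by positivity) (by linarith)
    rw [Real.log_mul (by norm_num) (by norm_num)] at e
    norm_num at e
    linarith

theorem c₀_bounds : 0.132642545 ≤ c₀ ∧ c₀ < 0.132642546 := by
  obtain ⟨s1, s2⟩ := sqrt_two_bounds
  obtain ⟨l1, l2⟩ := log_one_add_sqrt_two_bounds
  have p1 := Real.pi_gt_d20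
  have p2 := Real.pi_lt_d20
  have d1 : 3.14159265358 * 1.41421356237 ≤ Real.pi * √2 := by gcongr; linarith
  have d2 : Real.pi * √2 ≤ 3.14159265359 * 1.41421356238 := by gcongr; linarith
  have hD : 0 < 2 * Real.pi * √2 := by positivity
  set N := 4 / 15 + 2 * Real.log (1 + √2) / 3 + 2 * √2 / 15 with hN
  have e : c₀ = 1 / 4 - N / (2 * Real.pi * √2) := by rw [c₀, hN]; ring
  have u : N / (2 * Real.pi * √2) ≤ 0.117357455 := by
    rw [div_le_iff₀ hD]; linarith
  have v : 0.117357454 < N / (2 * Real.pi * √2) := by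
    rw [lt_div_iff₀ hD]; linarith
  rw [e]
  constructor <;> linarith

end GaussCircle

theorem theorem1p1 :
    (∃ C : ℝ, ∀ R : ℝ, 0 < R →
      |GaussCircle.mean R - 1 / 2| ≤ C * R ^ (-(1 / 3) : ℝ)) ∧
    Tendsto GaussCircle.variance atTop (𝓝 GaussCircle.c₀) ∧
    (0.132642545 ≤ GaussCircle.c₀ ∧ GaussCircle.c₀ < 0.132642546) :=
  ⟨⟨20000, fun _ hR => GaussCircle.abs_mean_sub_half_le hR⟩, GaussCircle.tendsto_variance,
    GaussCircle.c₀_bounds⟩
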